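/- **Proposition 2.2.** Let $\varphi=[F_0:\dots:F_{n+1}]:\mathbb P^n\dashrightarrow\mathbb P^{n+1}$ be a rational map of complex projective spaces given by quadratic forms $F_0,\dots,F_{n+1}$ in $n+1$ variables without a nonconstant common factor. Suppose that the closure of its image is a normal irreducible hypersurface $S\subset\mathbb P^{n+1}$ of degree at least $2$ and that $\varphi:\mathbb P^n\dashrightarrow S$ is birational. Let $B\subset\mathbb P^n$ be the base locus of $\varphi$, i.e. the closed subscheme $V(F_0,\dots,F_{n+1})$, with ideal sheaf $\mathcal I_B$. The following conditions are equivalent: 1. $h^0(\mathbb P^n,\mathcal I_B(1))\neq 0$, i.e. $B$ lies (scheme-theoretically) in a hyperplane; 2. $B$ is a quadric of codimension $2$, i.e. $B=V(\ell,q)$ as schemes, for a nonzero linear form $\ell$ and a quadratic form $q$ not divisible by $\ell$; 3. $B$ is a complete intersection, i.e. it is the scheme-theoretic intersection of $c$ hypersurfaces, where $c$ is the codimension of $B$ in $\mathbb P^n$ (the empty scheme has codimension $n+1$); 4. $\varphi$ is of type $(2,1)$, i.e. $1$ is the least integer $d$ such that $\varphi^{-1}:S\dashrightarrow\mathbb P^n$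 can be defined by a linear system contained in $|\mathcal O_S(d)|$. If one of these conditions is satisfied, then $S$ is a quadric and $\operatorname{rk}(B)=\operatorname{rk}(S)-2$. Here $\operatorname{rk}(S)$ is the rank of the quadratic form defining $S$, and $\operatorname{rk}(B)$ is the rank of the quadratic form $q|_{\{\ell=0\}}$, for any $\ell,q$ as in condition 2. -/

import Mathlib

namespace QuadraticMaps

open MvPolynomial

noncomputable section

/-- The saturation of an ideal `I` of the homogeneous coordinate ring of a projective space: the
polynomials that lie in `I` after localizing at each variable, i.e. on each standard chart.
For a homogeneous ideal `I` this is the (saturated) homogeneous ideal of the closed subscheme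
`V(I)` of projective space; two homogeneous ideals define the same closed subscheme if and only
if they have the same saturation. -/
def saturation {m : ℕ} (I : Ideal (MvPolynomial (Fin m) ℂ)) :
    Ideal (MvPolynomial (Fin m) ℂ) where
  carrier := {f | ∀ i, ∃ k : ℕ, X i ^ k * f ∈ I}
  zero_mem' := fun i => ⟨0, by simp⟩
  add_mem' := by
    intro a b ha hb i
    obtain ⟨k, hk⟩ := ha i
    obtain ⟨l, hl⟩ := hb i
    refine ⟨k + l, ?_⟩
    have h : (X i : MvPolynomial (Fin m) ℂ) ^ (k + l) * (a + b)
        = X i ^ l * (X i ^ k * a) + X i ^ k * (X i ^ l * b) := by ring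
    rw [h]
    exact I.add_mem (I.mul_mem_left _ hk) (I.mul_mem_left _ hl)
  smul_mem' := by
    intro c a ha i
    obtain ⟨k, hk⟩ := ha i
    refine ⟨k, ?_⟩
    have h : (X i : MvPolynomial (Fin m) ℂ) ^ k * (c • a) = c * (X i ^ k * a) := by
      rw [smul_eq_mul]; ring
    rw [h]
    exact I.mul_mem_left _ hk

/-- The ideals `I` and `J` define the same closed subscheme of projective space. -/
def SameSubscheme {m : ℕ} (I J : Ideal (MvPolynomial (Fin m) ℂ)) : Prop :=
  saturation I = saturation J

/-- The global sections `H⁰(ℙⁿ, 𝓘_B(k))` of the `k`-th twist of the ideal sheaf of `B = V(I) ⊆ ℙⁿ`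
(`m = n + 1` variables): the forms of degree `k` that vanish on the scheme `B`. -/
def twistedSections {m : ℕ} (I : Ideal (MvPolynomial (Fin m) ℂ)) (k : ℕ) :
    Submodule ℂ (MvPolynomial (Fin m) ℂ) :=
  homogeneousSubmodule (Fin m) ℂ k ⊓ (saturation I).restrictScalars ℂ

/-- The closed subscheme `V(I)` is the quadric of codimension two cut out by the linear
form `l` and the quadratic form `q`: it is the quadric hypersurface `q = 0` of the
hyperplane `l = 0`, as a scheme. -/
structure IsCodimTwoQuadricCutBy {m : ℕ} (I : Ideal (MvPolynomial (Fin m) ℂ))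
    (l q : MvPolynomial (Fin m) ℂ) : Prop where
  linear : l.IsHomogeneous 1
  ne_zero : l ≠ 0
  quadratic : q.IsHomogeneous 2
  not_dvd : ¬ l ∣ q
  same : SameSubscheme I (Ideal.span {l, q})

/-- `V(I)` is a quadric of codimension two. -/
def IsCodimTwoQuadric {m : ℕ} (I : Ideal (MvPolynomial (Fin m) ℂ)) : Prop :=
  ∃ l q, IsCodimTwoQuadricCutBy I l q

/-- `V(I)` is a complete intersection: it is the scheme-theoretic intersection of `c`
hypersurfaces, where `c` is its codimension. The codimension is the height of the ideal
generated by the equations, so the empty scheme has codimension `n + 1` in `ℙⁿ`. -/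
def IsCompleteIntersection {m : ℕ} (I : Ideal (MvPolynomial (Fin m) ℂ)) : Prop :=
  ∃ (c : ℕ) (g : Fin c → MvPolynomial (Fin m) ℂ),
    (∀ i, ∃ d : ℕ, 0 < d ∧ (g i).IsHomogeneous d) ∧
    (Ideal.span (Set.range g)).height = (c : ℕ∞) ∧
    SameSubscheme I (Ideal.span (Set.range g))

/-- The tuples of forms `P` and `Q` are not identically zero on the projective variety with
(prime) homogeneous ideal `I`, and they define the same rational map on it. -/
def SameRationalMap {m r : ℕ} (I : Ideal (MvPolynomial (Fin m) ℂ))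
    (P Q : Fin r → MvPolynomial (Fin m) ℂ) : Prop :=
  (∃ i, P i ∉ I) ∧ (∃ i, Q i ∉ I) ∧ ∀ i j, P i * Q j - P j * Q i ∈ I

/-- Let `S = V(G) ⊆ ℙⁿ⁺¹` and let `F` define a rational map `φ : ℙⁿ ⇢ S`. The forms
`H₀, …, Hₙ` of degree `d`, i.e. sections of `𝓞_S(d)`, define a rational map `S ⇢ ℙⁿ` that is
inverse to `φ`: both compositions are the identity, as rational maps. -/
structure IsInverse {n : ℕ} (F : Fin (n + 2) → MvPolynomial (Fin (n + 1)) ℂ)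
    (G : MvPolynomial (Fin (n + 2)) ℂ) (d : ℕ)
    (H : Fin (n + 1) → MvPolynomial (Fin (n + 2)) ℂ) : Prop where
  homogeneous : ∀ i, (H i).IsHomogeneous d
  left_inv : SameRationalMap ⊥ (fun i => aeval F (H i)) X
  right_inv : SameRationalMap (Ideal.span {G}) (fun i => aeval H (F i)) X

/-- The hypersurface `V(G)` is normal: the coordinate ring of each of its standard affine
charts, where one of the coordinates is set equal to `1`, is integrally closed. -/
def IsNormalHypersurface {m : ℕ} (G : MvPolynomial (Fin m) ℂ) : Prop :=
  ∀ i, IsIntegrallyClosed (MvPolynomial (Fin m) ℂ ⧸ Ideal.span {G, X i - 1})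

/-- `φ = [F₀ : … : Fₙ₊₁]` is a quadratic birational map `ℙⁿ ⇢ S` onto the normal
nonlinear hypersurface `S = V(G) ⊆ ℙⁿ⁺¹`. -/
structure IsQuadraticBirational {n : ℕ} (F : Fin (n + 2) → MvPolynomial (Fin (n + 1)) ℂ)
    (G : MvPolynomial (Fin (n + 2)) ℂ) : Prop where
  /-- `φ` is given by quadratic forms. -/
  quadratic : ∀ i, (F i).IsHomogeneous 2
  /-- The linear system has no fixed component. -/
  no_fixed_component : ∀ p, (∀ i, p ∣ F i) → IsUnit p
  irreducible : Irreducible G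
  /-- `S` is a hypersurface of degree at least two. -/
  nonlinear : ∃ e, 2 ≤ e ∧ G.IsHomogeneous e
  /-- `S` is the closure of the image of `φ`: the forms that vanish on the image are the
  multiples of `G`. -/
  image : RingHom.ker (aeval F : MvPolynomial (Fin (n + 2)) ℂ →ₐ[ℂ] _) = Ideal.span {G}
  normal : IsNormalHypersurface G
  /-- `φ` has a rational inverse `S ⇢ ℙⁿ`. -/
  birational : ∃ d H, IsInverse F G d H

/-- The base locus of `[F₀ : … : Fₙ₊₁]` is the closed subscheme defined by this ideal. -/
def baseIdeal {n : ℕ} (F : Fin (n + 2) → MvPolynomial (Fin (n + 1)) ℂ) :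
    Ideal (MvPolynomial (Fin (n + 1)) ℂ) :=
  Ideal.span (Set.range F)

/-- A quadratic birational map `φ : ℙⁿ ⇢ S = V(G)` is of type `(2, d)`: `d` is the least
degree such that `φ⁻¹` can be defined by a linear system contained in `|𝓞_S(d)|`. -/
def IsOfTypeTwo {n : ℕ} (F : Fin (n + 2) → MvPolynomial (Fin (n + 1)) ℂ)
    (G : MvPolynomial (Fin (n + 2)) ℂ) (d : ℕ) : Prop :=
  IsLeast {d | ∃ H, IsInverse F G d H} d

/-- The Hessian matrix of a quadratic form, i.e. the Gram matrix of its polar form. -/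
def hessian {m : ℕ} (q : MvPolynomial (Fin m) ℂ) : Matrix (Fin m) (Fin m) ℂ :=
  Matrix.of fun i j => coeff 0 (pderiv i (pderiv j q))

/-- The linear hyperplane of `ℂᵐ` where the linear form `l` vanishes. -/
def hyperplane {m : ℕ} (l : MvPolynomial (Fin m) ℂ) : Submodule ℂ (Fin m → ℂ) :=
  LinearMap.ker (∑ i, coeff (Finsupp.single i 1) l • LinearMap.proj (R := ℂ) (φ := fun _ => ℂ) i)

/-- The rank of the restriction of the quadratic form `q` to a linear subspace `W`. -/
def rankOn {m : ℕ} (q : MvPolynomial (Fin m) ℂ) (W : Submodule ℂ (Fin m → ℂ)) : ℕ :=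
  Module.finrank ℂ
    (LinearMap.range (LinearMap.BilinForm.restrict (Matrix.toBilin' (hessian q)) W))

end

end QuadraticMaps

/-!
The point is that the linear system of a quadratic birational map onto a normal hypersurface is
complete: every quadric `Q` that contains the base scheme `B` is a linear combination of the `F i`
(`IsQuadraticBirational.mem_span_of_mem_saturation`). On the chart `y i ≠ 0` of `S` the ratio
`Q / F i` is a rational function because the map is birational. It is integral: it maps the finite
module of the forms of a large degree `N` into itself, since the products of these forms with `Q`
lie in the ideal of the `F j`. So it is regular by normality. Hence `Q` is multiplied into the
homogeneous coordinate ring `ℂ[F] ≅ ℂ[y] / (G)` by a power of each coordinate. As `n + 2 ≥ 3`, that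
ring has depth at least two along three of its coordinates and contains `Q`
(`mem_range_aeval_of_three_pow_mul_mem`), so `Q` is a linear form in the `F i` by its degree.

If `B` lies in the hyperplane `l = 0`, some `q = F i` is not divisible by `l`, and the `n + 2`
quadrics `l x₀, …, l xₙ, q` contain `B`. By completeness they form a basis of the linear system,
so `B = V(l, q)`. In suitable coordinates the map is `x ↦ [l x : q]` (`IsAdaptedCoordinates`): its
inverse is the linear projection that forgets the last coordinate, its image is the quadric
`q(x) = l(x) z`, and comparing the radicals of `q(x) - l(x) z` and of `q` on `l = 0` gives the
relation between the ranks. Conversely, if linear forms `H j` define the inverse, then their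
pullbacks are `l x_j` with a linear form `l`, and `l` vanishes on `B`.

Finally let `B` be the intersection of `c` hypersurfaces `g i = 0`, with `c` its codimension. If
`c = n + 1`, then `B` is empty. If `c ≤ n`, then the ideal of the `g i` is saturated
(`mem_span_range_of_mem_saturation`), because the local ring of `ℂⁿ⁺¹` at the origin is
Cohen-Macaulay. If `B` were in no hyperplane, all the nonzero `g i` would have degree at least two,
and the `n + 2` independent forms `F k` would be linear combinations of the at most `n` forms `g i`
of degree two.
-/

namespace QuadraticMaps

open MvPolynomial

/-! ### Homogeneous polynomials -/

/-- Homogeneity as a scaling law. -/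
lemma aeval_mul_of_isHomogeneous {σ A : Type*} [CommRing A] [Algebra ℂ A]
    {P : MvPolynomial σ ℂ} {d : ℕ} (hP : P.IsHomogeneous d) (c : A) (v : σ → A) :
    aeval (fun j => c * v j) P = c ^ d * aeval v P := by
  rw [aeval_def, aeval_def, eval₂_eq, eval₂_eq, Finset.mul_sum]
  refine Finset.sum_congr rfl fun m hm => ?_
  simp only [mul_pow, Finset.prod_mul_distrib, Finset.prod_pow_eq_pow_sum]
  rw [← hP.degree_eq_sum_deg_support hm]
  ring

lemma homogeneousComponent_mul_of_isHomogeneous {σ : Type*} {g : MvPolynomial σ ℂ} {d : ℕ}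
    (hg : g.IsHomogeneous d) (a : MvPolynomial σ ℂ) (e : ℕ) :
    homogeneousComponent e (a * g) = if d ≤ e then homogeneousComponent (e - d) a * g else 0 := by
  classical
  conv_lhs => rw [← sum_homogeneousComponent a, Finset.sum_mul, map_sum]
  have h : ∀ i, homogeneousComponent e (homogeneousComponent i a * g)
      = if i + d = e then homogeneousComponent i a * g else 0 := fun i => by
    rw [homogeneousComponent_of_mem ((homogeneousComponent_isHomogeneous i a).mul hg)]
    simp only [eq_comm]
  simp only [h]
  split_ifs with hde
  · rw [Finset.sum_eq_single (e - d)]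
    · simp [Nat.sub_add_cancel hde]
    · intro i _ hi
      rw [if_neg (by omega)]
    · intro hi
      rw [homogeneousComponent_eq_zero _ _ (by rw [Finset.mem_range] at hi; omega)]
      simp
  · exact Finset.sum_eq_zero fun i _ => if_neg (by omega)

/-- A form in an ideal generated by forms is a combination of them with homogeneous coefficients
of the complementary degrees. -/
lemma exists_homogeneous_coeff_of_mem_span {σ ι : Type*} [Fintype ι] {g : ι → MvPolynomial σ ℂ}
    {d : ι → ℕ} (hg : ∀ i, (g i).IsHomogeneous (d i)) {f : MvPolynomial σ ℂ} {e : ℕ}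
    (hf : f.IsHomogeneous e) (h : f ∈ Ideal.span (Set.range g)) :
    ∃ a : ι → MvPolynomial σ ℂ, (∀ i, (a i).IsHomogeneous (e - d i)) ∧
      (∀ i, e < d i → a i = 0) ∧ f = ∑ i, a i * g i := by
  obtain ⟨a, ha⟩ := (Ideal.mem_span_range_iff_exists_fun).1 h
  refine ⟨fun i => if d i ≤ e then homogeneousComponent (e - d i) (a i) else 0, ?_, ?_, ?_⟩
  · intro i
    dsimp only
    split_ifs
    · exact homogeneousComponent_isHomogeneous _ _
    · exact isHomogeneous_zero _ _ _
  · intro i hi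
    exact if_neg (by omega)
  · rw [← homogeneousComponent_eq_self hf, ← ha, map_sum]
    refine Finset.sum_congr rfl fun i _ => ?_
    rw [homogeneousComponent_mul_of_isHomogeneous (hg i)]
    by_cases hi : d i ≤ e
    · simp only [if_pos hi]
    · simp only [if_neg hi, zero_mul]

/-- If the polynomials `F` are forms of the same positive degree, then evaluation at `F` multiplies
degrees, so it commutes with taking homogeneous components. -/
lemma homogeneousComponent_aeval {σ τ : Type*} {F : σ → MvPolynomial τ ℂ} {d : ℕ} (hd : 0 < d)
    (hF : ∀ i, (F i).IsHomogeneous d) (P : MvPolynomial σ ℂ) (e : ℕ) :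
    homogeneousComponent (d * e) (aeval F P) = aeval F (homogeneousComponent e P) := by
  classical
  conv_lhs => rw [← sum_homogeneousComponent P, map_sum, map_sum]
  have h : ∀ i, homogeneousComponent (d * e) (aeval F (homogeneousComponent i P))
      = if i = e then aeval F (homogeneousComponent i P) else 0 := fun i => by
    rw [homogeneousComponent_of_mem
      ((homogeneousComponent_isHomogeneous i P).aeval F hF : IsHomogeneous _ _)]
    simp only [mul_eq_mul_left_iff, hd.ne', or_false, eq_comm]
  simp only [h, Finset.sum_ite_eq', Finset.mem_range]
  split_ifs with hi
  · rfl
  · rw [homogeneousComponent_eq_zero _ _ (by omega), map_zero]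

/-- A linear form evaluated at a family is a linear combination of the family. -/
lemma aeval_mem_span_of_isHomogeneous_one {σ A : Type*} [CommRing A] [Algebra ℂ A]
    {L : MvPolynomial σ ℂ} (hL : L.IsHomogeneous 1) (F : σ → A) :
    aeval F L ∈ Submodule.span ℂ (Set.range F) := by
  have h : L ∈ homogeneousSubmodule σ ℂ 1 := hL
  rw [homogeneousSubmodule_one_eq_span_X] at h
  have h2 := Submodule.mem_map_of_mem (f := (aeval F : MvPolynomial σ ℂ →ₐ[ℂ] A).toLinearMap) h
  have h3 : (aeval F : MvPolynomial σ ℂ →ₐ[ℂ] A).toLinearMap ∘ X = F := by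
    ext i
    simp
  rwa [Submodule.map_span, ← Set.range_comp, h3] at h2

lemma exists_isHomogeneous_one_of_mem_span {σ A : Type*} [Fintype σ] [CommRing A] [Algebra ℂ A]
    {F : σ → A} {a : A} (ha : a ∈ Submodule.span ℂ (Set.range F)) :
    ∃ L : MvPolynomial σ ℂ, L.IsHomogeneous 1 ∧ aeval F L = a := by
  obtain ⟨c, rfl⟩ := (Submodule.mem_span_range_iff_exists_fun ℂ).1 ha
  exact ⟨∑ i, C (c i) * X i, IsHomogeneous.sum _ _ _ fun i _ => isHomogeneous_C_mul_X _ _,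
    by simp [Algebra.smul_def]⟩

lemma not_isUnit_of_isHomogeneous {σ : Type*} {p : MvPolynomial σ ℂ} {d : ℕ} (hd : 0 < d)
    (hp : p.IsHomogeneous d) : ¬ IsUnit p := by
  intro hu
  have h1 := (hu.map (constantCoeff (R := ℂ) (σ := σ))).ne_zero
  exact h1 (hp.coeff_eq_zero (d := 0) (by simpa using hd.ne))

lemma irreducible_of_isHomogeneous_one {σ : Type*} {l : MvPolynomial σ ℂ}
    (hl : l.IsHomogeneous 1) (h0 : l ≠ 0) : Irreducible l := by
  refine irreducible_of_totalDegree_eq_one (hl.totalDegree h0) fun x hx => ?_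
  obtain ⟨m, hm⟩ := ne_zero_iff.1 h0
  exact isUnit_iff_ne_zero.2 fun h => hm (by simpa [h] using hx m)

lemma mem_span_X_of_X_mul_mem {σ : Type*} {s : Set σ} {k : σ} (hk : k ∉ s) {T : MvPolynomial σ ℂ}
    (h : X k * T ∈ Ideal.span (X '' s : Set (MvPolynomial σ ℂ))) :
    T ∈ Ideal.span (X '' s : Set (MvPolynomial σ ℂ)) := by
  classical
  rw [mem_ideal_span_X_image] at h ⊢
  intro m hm
  obtain ⟨t, ht, hmt⟩ := h (Finsupp.single k 1 + m) (by
    rw [mem_support_iff] at hm ⊢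
    rwa [coeff_X_mul])
  refine ⟨t, ht, ?_⟩
  have htk : t ≠ k := fun h => hk (h ▸ ht)
  simpa [Finsupp.single_eq_of_ne htk] using hmt

/-! ### Saturation -/

lemma le_saturation {m : ℕ} (I : Ideal (MvPolynomial (Fin m) ℂ)) : I ≤ saturation I :=
  fun f hf _ => ⟨0, by simpa using hf⟩

lemma saturation_mono {m : ℕ} {I J : Ideal (MvPolynomial (Fin m) ℂ)} (h : I ≤ J) :
    saturation I ≤ saturation J :=
  fun _ hf i => (hf i).imp fun _ hk => h hk

lemma saturation_saturation {m : ℕ} (I : Ideal (MvPolynomial (Fin m) ℂ)) :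
    saturation (saturation I) = saturation I := by
  refine le_antisymm (fun f hf i => ?_) (le_saturation _)
  obtain ⟨k, hk⟩ := hf i
  obtain ⟨e, he⟩ := hk i
  exact ⟨e + k, by rwa [pow_add, mul_assoc]⟩

lemma sameSubscheme_of_le {m : ℕ} {I J : Ideal (MvPolynomial (Fin m) ℂ)} (h : I ≤ J)
    (h' : J ≤ saturation I) : SameSubscheme I J :=
  le_antisymm (saturation_mono h) ((saturation_mono h').trans (saturation_saturation I).le)

/-- Some power of the irrelevant ideal multiplies a section over the closed subscheme into the
ideal. -/
lemma exists_idealOfVars_pow_mul_mem {m : ℕ} {I : Ideal (MvPolynomial (Fin m) ℂ)}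
    {Q : MvPolynomial (Fin m) ℂ} (hQ : Q ∈ saturation I) :
    ∃ N, ∀ v ∈ idealOfVars (Fin m) ℂ ^ N, v * Q ∈ I := by
  have h : idealOfVars (Fin m) ℂ ≤ (Submodule.colon I {Q}).radical := by
    rw [idealOfVars, Ideal.span_le]
    rintro _ ⟨i, rfl⟩
    obtain ⟨k, hk⟩ := hQ i
    exact ⟨k, by simpa [Submodule.mem_colon_singleton] using hk⟩
  obtain ⟨N, hN⟩ := Ideal.exists_pow_le_of_le_radical_of_fg h (idealOfVars_fg _ _)
  exact ⟨N, fun v hv => by simpa [Submodule.mem_colon_singleton] using hN hv⟩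

lemma finrank_twistedSections_ne_zero_iff {m : ℕ} (I : Ideal (MvPolynomial (Fin m) ℂ)) (k : ℕ) :
    Module.finrank ℂ (twistedSections I k) ≠ 0 ↔
      ∃ f : MvPolynomial (Fin m) ℂ, f.IsHomogeneous k ∧ f ∈ saturation I ∧ f ≠ 0 := by
  have : Module.Finite ℂ (homogeneousSubmodule (Fin m) ℂ k) :=
    Module.Finite.iff_fg.2 (homogeneousSubmodule_fg _ _ k)
  have : Module.Finite ℂ (twistedSections I k) :=
    Submodule.finiteDimensional_of_le (inf_le_left : _ ≤ homogeneousSubmodule (Fin m) ℂ k)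
  rw [ne_eq, Submodule.finrank_eq_zero, ← ne_eq, Submodule.ne_bot_iff]
  constructor
  · rintro ⟨f, ⟨h1, h2⟩, h3⟩
    exact ⟨f, h1, h2, h3⟩
  · rintro ⟨f, h1, h2, h3⟩
    exact ⟨f, ⟨h1, h2⟩, h3⟩

/-! ### The homogeneous coordinate ring of the image -/

/-- Three coordinates of `ℂ[y]/(G)` behave like a sequence of depth two: an element `q` of an
overring that is multiplied into `ℂ[y]/(G)` by three of the coordinates already lies there. With
`y_i q = P_i` one has `y_j P_i - y_i P_j = G T_ij`, the syzygy `y_k T_ij - y_j T_ik + y_i T_jk = 0`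
forces `T_ij ∈ (y_i, y_j)`, and so `P_i` is a multiple of `y_i` modulo `G`. -/
lemma mem_range_aeval_of_three_mul_mem {σ A : Type*} [CommRing A] [IsDomain A] [Algebra ℂ A]
    {F : σ → A} {G : MvPolynomial σ ℂ} (hG : G ≠ 0)
    (hker : RingHom.ker (aeval F : MvPolynomial σ ℂ →ₐ[ℂ] A) = Ideal.span {G})
    {i j k : σ} (hij : i ≠ j) (hik : i ≠ k) (hjk : j ≠ k) (hi0 : F i ≠ 0) {q : A}
    (hi : F i * q ∈ (aeval F : MvPolynomial σ ℂ →ₐ[ℂ] A).range)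
    (hj : F j * q ∈ (aeval F : MvPolynomial σ ℂ →ₐ[ℂ] A).range)
    (hk : F k * q ∈ (aeval F : MvPolynomial σ ℂ →ₐ[ℂ] A).range) :
    q ∈ (aeval F : MvPolynomial σ ℂ →ₐ[ℂ] A).range := by
  classical
  obtain ⟨Pi, hPi⟩ := hi
  obtain ⟨Pj, hPj⟩ := hj
  obtain ⟨Pk, hPk⟩ := hk
  replace hPi : aeval F Pi = F i * q := hPi
  replace hPj : aeval F Pj = F j * q := hPj
  replace hPk : aeval F Pk = F k * q := hPk
  have key : ∀ P, aeval F P = 0 → ∃ T, P = G * T := fun P hP => by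
    have : P ∈ RingHom.ker (aeval F : MvPolynomial σ ℂ →ₐ[ℂ] A) := hP
    rw [hker, Ideal.mem_span_singleton] at this
    exact this
  obtain ⟨Tij, h1⟩ := key (X j * Pi - X i * Pj) (by simp [hPi, hPj]; ring)
  obtain ⟨Tik, h2⟩ := key (X k * Pi - X i * Pk) (by simp [hPi, hPk]; ring)
  obtain ⟨Tjk, h3⟩ := key (X k * Pj - X j * Pk) (by simp [hPj, hPk]; ring)
  have h4 : X k * Tij - X j * Tik + X i * Tjk = 0 := by
    refine (mul_eq_zero.1 ?_).resolve_left hG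
    linear_combination (-X k) * h1 + X j * h2 - X i * h3
  have h5 : Tij ∈ Ideal.span (X '' {i, j} : Set (MvPolynomial σ ℂ)) := by
    have h6 : X k * Tij ∈ Ideal.span (X '' {i, j} : Set (MvPolynomial σ ℂ)) := by
      have : X k * Tij = Tik * X j - Tjk * X i := by linear_combination h4
      rw [this]
      exact sub_mem (Ideal.mul_mem_left _ _ (Ideal.subset_span ⟨j, by simp, rfl⟩))
        (Ideal.mul_mem_left _ _ (Ideal.subset_span ⟨i, by simp, rfl⟩))
    exact mem_span_X_of_X_mul_mem (by simp [hik.symm, hjk.symm]) h6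
  rw [Set.image_pair, Ideal.mem_span_pair] at h5
  obtain ⟨a, b, hab⟩ := h5
  have h7 : (X i : MvPolynomial σ ℂ) ∣ X j * (Pi - G * b) :=
    ⟨Pj + G * a, by linear_combination h1 - G * hab⟩
  obtain ⟨W, hW⟩ := ((irreducible_of_isHomogeneous_one (isHomogeneous_X ℂ i)
    (X_ne_zero i)).prime.dvd_or_dvd h7).resolve_left
    (fun h => hij (X_dvd_X.1 h))
  have hGF : aeval F G = 0 := by
    have : G ∈ RingHom.ker (aeval F : MvPolynomial σ ℂ →ₐ[ℂ] A) :=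
      hker ▸ Ideal.mem_span_singleton_self G
    exact this
  refine ⟨W, mul_left_cancel₀ hi0 ?_⟩
  have h8 := congrArg (aeval F) hW
  simp only [map_sub, map_mul, aeval_X, hGF, zero_mul, sub_zero, hPi] at h8
  simpa using h8.symm

/-- The same with powers of the coordinates: the image ring is saturated. -/
lemma mem_range_aeval_of_three_pow_mul_mem {σ A : Type*} [CommRing A] [IsDomain A] [Algebra ℂ A]
    {F : σ → A} {G : MvPolynomial σ ℂ} (hG : G ≠ 0)
    (hker : RingHom.ker (aeval F : MvPolynomial σ ℂ →ₐ[ℂ] A) = Ideal.span {G})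
    {i j k : σ} (hij : i ≠ j) (hik : i ≠ k) (hjk : j ≠ k) (hi0 : F i ≠ 0) :
    ∀ (N a b c : ℕ), a + b + c ≤ N → ∀ q : A,
    F i ^ a * q ∈ (aeval F : MvPolynomial σ ℂ →ₐ[ℂ] A).range →
    F j ^ b * q ∈ (aeval F : MvPolynomial σ ℂ →ₐ[ℂ] A).range →
    F k ^ c * q ∈ (aeval F : MvPolynomial σ ℂ →ₐ[ℂ] A).range →
    q ∈ (aeval F : MvPolynomial σ ℂ →ₐ[ℂ] A).range := by
  have hF : ∀ t, F t ∈ (aeval F : MvPolynomial σ ℂ →ₐ[ℂ] A).range := fun t => ⟨X t, by simp⟩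
  have hmul : ∀ {t : σ} {s : ℕ} (u : σ) (r : ℕ) {q : A},
      F t ^ s * q ∈ (aeval F : MvPolynomial σ ℂ →ₐ[ℂ] A).range →
      F t ^ s * (F u ^ r * q) ∈ (aeval F : MvPolynomial σ ℂ →ₐ[ℂ] A).range := by
    intro t s u r q h
    rw [mul_left_comm]
    exact mul_mem (pow_mem (hF u) r) h
  intro N
  induction N with
  | zero =>
    intro a b c h q ha _ _
    obtain rfl : a = 0 := by omega
    simpa using ha
  | succ N ih =>
    intro a b c h q ha hb hc
    rcases Nat.eq_zero_or_pos a with rfl | ha'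
    · simpa using ha
    rcases Nat.eq_zero_or_pos b with rfl | hb'
    · simpa using hb
    rcases Nat.eq_zero_or_pos c with rfl | hc'
    · simpa using hc
    obtain ⟨a, rfl⟩ := Nat.exists_eq_add_of_lt ha'
    obtain ⟨b, rfl⟩ := Nat.exists_eq_add_of_lt hb'
    obtain ⟨c, rfl⟩ := Nat.exists_eq_add_of_lt hc'
    simp only [zero_add] at *
    refine mem_range_aeval_of_three_mul_mem hG hker hij hik hjk hi0 ?_ ?_ ?_
    · refine ih a (b + 1) (c + 1) (by omega) _ ?_ ?_ ?_
      · rwa [← mul_assoc, ← pow_succ]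
      · simpa using hmul i 1 hb
      · simpa using hmul i 1 hc
    · refine ih (a + 1) b (c + 1) (by omega) _ ?_ ?_ ?_
      · simpa using hmul j 1 ha
      · rwa [← mul_assoc, ← pow_succ]
      · simpa using hmul j 1 hc
    · refine ih (a + 1) (b + 1) c (by omega) _ ?_ ?_ ?_
      · simpa using hmul k 1 ha
      · simpa using hmul k 1 hb
      · rwa [← mul_assoc, ← pow_succ]

/-! ### Affine charts -/

/-- Homogenization with respect to the coordinate `X i`, up to the relation `X i = 1`. -/
lemma exists_homogenization {σ : Type*} (i : σ) (P : MvPolynomial σ ℂ) :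
    ∃ (D : ℕ) (P' : MvPolynomial σ ℂ), P'.IsHomogeneous D ∧
      P - P' ∈ Ideal.span {(X i - 1 : MvPolynomial σ ℂ)} := by
  refine ⟨P.totalDegree, ∑ d ∈ Finset.range (P.totalDegree + 1),
    X i ^ (P.totalDegree - d) * homogeneousComponent d P, ?_, ?_⟩
  · refine IsHomogeneous.sum _ _ _ fun d hd => ?_
    have := (isHomogeneous_X_pow (R := ℂ) i (P.totalDegree - d)).mul
      (homogeneousComponent_isHomogeneous d P)
    rwa [Nat.sub_add_cancel (by rw [Finset.mem_range] at hd; omega)] at this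
  · conv => enter [2, 1]; rw [← sum_homogeneousComponent P]
    rw [← Finset.sum_sub_distrib]
    refine Ideal.sum_mem _ fun d _ => ?_
    rw [Ideal.mem_span_singleton, ← dvd_neg]
    have h : (X i - 1 : MvPolynomial σ ℂ) ∣ X i ^ (P.totalDegree - d) - 1 := by
      simpa using sub_dvd_pow_sub_pow (X i : MvPolynomial σ ℂ) 1 (P.totalDegree - d)
    obtain ⟨c, hc⟩ := h
    exact ⟨c * homogeneousComponent d P, by linear_combination homogeneousComponent d P * hc⟩

/-- The chart `X i ≠ 0` of the projective variety with homogeneous ideal `(G)` and generic point `f`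
has generic point `(f j / f i)`: the ratios satisfy no equations but those of the chart. -/
lemma ker_aeval_div {σ K : Type*} [Field K] [Algebra ℂ K] {f : σ → K} {G : MvPolynomial σ ℂ}
    {e : ℕ} (hG : G.IsHomogeneous e)
    (hker : RingHom.ker (aeval f : MvPolynomial σ ℂ →ₐ[ℂ] K) = Ideal.span {G})
    {i : σ} (hi : f i ≠ 0) :
    RingHom.ker (aeval (fun j => (f i)⁻¹ * f j) : MvPolynomial σ ℂ →ₐ[ℂ] K)
      = Ideal.span {G, X i - 1} := by
  have hX : (aeval (fun j => (f i)⁻¹ * f j) : MvPolynomial σ ℂ →ₐ[ℂ] K) (X i - 1) = 0 := by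
    simp [hi]
  refine le_antisymm (fun P hP => ?_) ?_
  · obtain ⟨D, P', hP', hd⟩ := exists_homogenization i P
    have h1 : P - P' ∈ Ideal.span {G, X i - 1} :=
      Ideal.span_mono (by simp) hd
    have h2 : aeval (fun j => (f i)⁻¹ * f j) P' = 0 := by
      obtain ⟨c, hc⟩ := Ideal.mem_span_singleton.1 hd
      have h3 : P' = P - (X i - 1) * c := by linear_combination -hc
      have h4 : aeval (fun j => (f i)⁻¹ * f j) P = 0 := hP
      rw [h3, map_sub, map_mul, hX, h4, zero_mul, sub_zero]
    rw [aeval_mul_of_isHomogeneous hP'] at h2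
    have h3 : P' ∈ RingHom.ker (aeval f : MvPolynomial σ ℂ →ₐ[ℂ] K) :=
      (mul_eq_zero.1 h2).resolve_left (pow_ne_zero _ (inv_ne_zero hi))
    rw [hker] at h3
    have h4 : P' ∈ Ideal.span {G, X i - 1} := Ideal.span_mono (by simp) h3
    simpa using add_mem h1 h4
  · rw [Ideal.span_le, Set.insert_subset_iff, Set.singleton_subset_iff]
    constructor
    · have : G ∈ RingHom.ker (aeval f : MvPolynomial σ ℂ →ₐ[ℂ] K) :=
        hker ▸ Ideal.mem_span_singleton_self G
      change aeval _ G = 0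
      rw [aeval_mul_of_isHomogeneous hG, (this : aeval f G = 0), mul_zero]
    · exact hX

/-- An integral element that is a quotient of two elements of an integrally closed domain lies in
that domain. -/
lemma exists_algebraMap_eq_of_isIntegral {A K : Type*} [CommRing A] [IsDomain A]
    [IsIntegrallyClosed A] [Field K] [Algebra A K] [FaithfulSMul A K] {x : K} {a b : A}
    (hb : b ≠ 0) (h : algebraMap A K b * x = algebraMap A K a) (hx : IsIntegral A x) :
    ∃ y, algebraMap A K y = x := by
  let L := FractionRing A
  let : Algebra L K := FractionRing.liftAlgebra A K
  have hLK : IsScalarTower A L K := inferInstance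
  let z : L := algebraMap A L a / algebraMap A L b
  have hb' : algebraMap A K b ≠ 0 := by
    rwa [ne_eq, FaithfulSMul.algebraMap_eq_zero_iff]
  have hz : algebraMap L K z = x := by
    rw [map_div₀, ← IsScalarTower.algebraMap_apply, ← IsScalarTower.algebraMap_apply, ← h]
    field_simp
  have hzi : IsIntegral A z := by
    rw [← hz] at hx
    exact (isIntegral_algHom_iff (IsScalarTower.toAlgHom A L K)
      (algebraMap L K).injective).1 hx
  obtain ⟨y, hy⟩ := IsIntegrallyClosed.isIntegral_iff.1 hzi
  exact ⟨y, by rw [← hz, ← hy, ← IsScalarTower.algebraMap_apply]⟩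

/-! ### Quadrics through the base locus -/

section Completeness

variable {n : ℕ} {F : Fin (n + 2) → MvPolynomial (Fin (n + 1)) ℂ}
  {G : MvPolynomial (Fin (n + 2)) ℂ}

/-- The hypersurface `S` lies in no hyperplane. -/
lemma IsQuadraticBirational.eq_zero_of_aeval_eq_zero (hφ : IsQuadraticBirational F G)
    {L : MvPolynomial (Fin (n + 2)) ℂ} (hL : L.IsHomogeneous 1) (h : aeval F L = 0) : L = 0 := by
  have h1 : L ∈ RingHom.ker (aeval F : MvPolynomial (Fin (n + 2)) ℂ →ₐ[ℂ] _) := h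
  rw [hφ.image, Ideal.mem_span_singleton] at h1
  obtain ⟨c, hc⟩ := h1
  by_contra hL0
  obtain ⟨e, he, hG⟩ := hφ.nonlinear
  have hc0 : c ≠ 0 := by
    rintro rfl
    simp [hc] at hL0
  have h2 := totalDegree_mul_of_isDomain hφ.irreducible.ne_zero hc0
  rw [← hc, hL.totalDegree hL0, hG.totalDegree hφ.irreducible.ne_zero] at h2
  omega

lemma IsQuadraticBirational.linearIndependent (hφ : IsQuadraticBirational F G) :
    LinearIndependent ℂ F := by
  rw [Fintype.linearIndependent_iff]
  intro c hc i
  have h := hφ.eq_zero_of_aeval_eq_zero (L := ∑ i, C (c i) * X i)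
    (IsHomogeneous.sum _ _ _ fun i _ => isHomogeneous_C_mul_X _ _)
    (by simpa [Algebra.smul_def] using hc)
  have h2 := congrArg (coeff (Finsupp.single i 1)) h
  simpa [coeff_sum, coeff_C_mul, coeff_X, Finsupp.single_left_inj] using h2

lemma IsQuadraticBirational.ne_zero (hφ : IsQuadraticBirational F G) (i : Fin (n + 2)) :
    F i ≠ 0 :=
  hφ.linearIndependent.ne_zero i

/-- Rational maps from a point do not satisfy the hypotheses: the forms `F i` would all be
multiples of the square of the only coordinate. -/
lemma IsQuadraticBirational.pos (hφ : IsQuadraticBirational F G) : 0 < n := by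
  rw [Nat.pos_iff_ne_zero]
  rintro rfl
  have h := hφ.no_fixed_component (X 0) fun i => by
    rw [X_dvd_iff_modMonomial_eq_zero, MvPolynomial.ext_iff]
    intro m
    by_cases hm : Finsupp.single 0 1 ≤ m
    · rw [coeff_modMonomial_of_le _ hm, coeff_zero]
    · rw [coeff_modMonomial_of_not_le _ hm, coeff_zero]
      refine (hφ.quadratic i).coeff_eq_zero fun h2 => hm ?_
      rw [Finsupp.single_le_iff]
      simp [Finsupp.degree_eq_sum] at h2
      omega
  exact not_isUnit_of_isHomogeneous one_pos (isHomogeneous_X _ _) h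

/-- On forms of degree `e`, substituting the inverse map into the map multiplies by the `e`-th power
of a common factor. -/
lemma IsInverse.pow_mul_aeval {d : ℕ} {H : Fin (n + 1) → MvPolynomial (Fin (n + 2)) ℂ}
    (hH : IsInverse F G d H) {Q : MvPolynomial (Fin (n + 1)) ℂ} {e : ℕ} (hQ : Q.IsHomogeneous e)
    (k : Fin (n + 1)) :
    X k ^ e * aeval F (aeval H Q) = aeval F (H k) ^ e * Q := by
  have h1 : aeval F (aeval H Q) = aeval (fun j => aeval F (H j)) Q := by
    rw [← AlgHom.comp_apply, comp_aeval]
  rw [h1, ← aeval_mul_of_isHomogeneous hQ]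
  have h2 : (fun j => X k * aeval F (H j)) = fun j => aeval F (H k) * X j := by
    ext1 j
    have := hH.left_inv.2.2 k j
    rw [Ideal.mem_bot] at this
    linear_combination -this
  rw [h2, aeval_mul_of_isHomogeneous hQ, aeval_X_left_apply]

/-- On each chart of the image, a quadric containing the base scheme is a regular function, up to
a power of the coordinate: it is integral over the coordinate ring of the chart since it maps the
forms of large degree `N` into the combinations of the `F j` with coefficients of degree `N`,
and it lies in the field of fractions because the map is birational. -/
lemma IsQuadraticBirational.exists_pow_mul_mem_range (hφ : IsQuadraticBirational F G)
    {Q : MvPolynomial (Fin (n + 1)) ℂ} (hQ2 : Q.IsHomogeneous 2)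
    (hQ : Q ∈ saturation (baseIdeal F)) (i : Fin (n + 2)) :
    ∃ k, F i ^ k * Q ∈ (aeval F : MvPolynomial (Fin (n + 2)) ℂ →ₐ[ℂ] _).range := by
  let S := MvPolynomial (Fin (n + 1)) ℂ
  let K := FractionRing S
  let ι := algebraMap S K
  have hι : Function.Injective ι := IsFractionRing.injective S K
  let f : Fin (n + 2) → K := fun j => ι (F j)
  have hf : ∀ P, aeval f P = ι (aeval F P) := fun P => by
    have := (IsScalarTower.toAlgHom ℂ S K).comp_apply (aeval F) P
    rw [comp_aeval] at this
    exact this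
  have hfi : f i ≠ 0 := fun h => hφ.ne_zero i (hι (by rw [map_zero]; exact h))
  obtain ⟨e, he, hGe⟩ := hφ.nonlinear
  have hkerf : RingHom.ker (aeval f : MvPolynomial (Fin (n + 2)) ℂ →ₐ[ℂ] K) = Ideal.span {G} := by
    rw [← hφ.image]
    ext P
    simp only [RingHom.mem_ker]
    rw [hf, map_eq_zero_iff ι hι]
  let ψ : MvPolynomial (Fin (n + 2)) ℂ →ₐ[ℂ] K := aeval (fun j => (f i)⁻¹ * f j)
  have hkerψ : RingHom.ker ψ = Ideal.span {G, X i - 1} := ker_aeval_div hGe hkerf hfi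
  let A := MvPolynomial (Fin (n + 2)) ℂ ⧸ Ideal.span {G, X i - 1}
  let alg : A →+* K := Ideal.Quotient.lift _ ψ.toRingHom fun a ha => by
    rw [← hkerψ] at ha
    exact ha
  have halg : Function.Injective alg :=
    Ideal.injective_lift_iff _ |>.2 hkerψ
  let _ : Algebra A K := alg.toAlgebra
  have hmk : ∀ P, algebraMap A K (Ideal.Quotient.mk _ P) = ψ P := fun P => rfl
  have hψ : ∀ {P : MvPolynomial (Fin (n + 2)) ℂ} {d : ℕ}, P.IsHomogeneous d →
      ψ P = (f i)⁻¹ ^ d * ι (aeval F P) := fun hP => by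
    rw [← hf]
    exact aeval_mul_of_isHomogeneous hP _ _
  have : FaithfulSMul A K := (faithfulSMul_iff_algebraMap_injective A K).2 halg
  have : IsDomain A := halg.isDomain
  have : IsIntegrallyClosed A := hφ.normal i
  let x : K := (f i)⁻¹ * ι Q
  -- `x = Q / F i` is a quotient of two elements of the coordinate ring of the chart
  obtain ⟨d, H, hH⟩ := hφ.birational
  obtain ⟨k, hk⟩ := hH.left_inv.1
  rw [Ideal.mem_bot] at hk
  have hXk : (X k : S) ≠ 0 := X_ne_zero k
  have hFiH : aeval F (aeval H (F i)) ≠ 0 := by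
    intro h0
    have := hH.pow_mul_aeval (hφ.quadratic i) k
    rw [h0, mul_zero, eq_comm, mul_eq_zero] at this
    exact this.elim (pow_ne_zero _ hk) (hφ.ne_zero i)
  have hquot : aeval F (aeval H (F i)) * Q = aeval F (aeval H Q) * F i := by
    refine mul_left_cancel₀ (pow_ne_zero 2 hXk) ?_
    linear_combination Q * hH.pow_mul_aeval (hφ.quadratic i) k - F i * hH.pow_mul_aeval hQ2 k
  have hb : (Ideal.Quotient.mk _ (aeval H (F i)) : A) ≠ 0 := by
    intro h0
    have h1 := hmk (aeval H (F i))
    rw [h0, map_zero, hψ ((hφ.quadratic i).aeval H hH.homogeneous), eq_comm, mul_eq_zero] at h1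
    exact h1.elim (pow_ne_zero _ (inv_ne_zero hfi)) (fun h => hFiH (hι (by rw [h, map_zero])))
  have hab : algebraMap A K (Ideal.Quotient.mk _ (aeval H (F i))) * x
      = algebraMap A K (Ideal.Quotient.mk _ (aeval H Q)) := by
    rw [hmk, hmk, hψ ((hφ.quadratic i).aeval H hH.homogeneous), hψ (hQ2.aeval H hH.homogeneous)]
    have h1 := congrArg ι hquot
    rw [map_mul, map_mul] at h1
    have h2 : (f i)⁻¹ * ι (F i) = 1 := inv_mul_cancel₀ hfi
    linear_combination (f i)⁻¹ ^ (d * 2) * (f i)⁻¹ * h1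
      + (f i)⁻¹ ^ (d * 2) * ι (aeval F (aeval H Q)) * h2
  -- `x` is integral over the coordinate ring of the chart
  have hx : IsIntegral A x := by
    obtain ⟨N, hN⟩ := exists_idealOfVars_pow_mul_mem hQ
    obtain ⟨t, ht⟩ := homogeneousSubmodule_fg (Fin (n + 1)) ℂ N
    have htN : ∀ v ∈ t, v.IsHomogeneous N := fun v hv => by
      have : v ∈ homogeneousSubmodule (Fin (n + 1)) ℂ N := ht ▸ Submodule.subset_span hv
      exact this
    let M : Submodule A K := Submodule.span A (ι '' t)
    have hM : ∀ v : S, v.IsHomogeneous N → ι v ∈ M := fun v hv => by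
      have : v ∈ Submodule.span ℂ (t : Set S) := ht ▸ hv
      clear hv
      induction this using Submodule.span_induction with
      | mem v hv => exact Submodule.subset_span ⟨v, hv, rfl⟩
      | zero => rw [map_zero]; exact M.zero_mem
      | add u v _ _ hu hv' =>
        rw [map_add]
        exact M.add_mem hu hv'
      | smul c v _ hv' =>
        have h1 : ι (c • v) = (Ideal.Quotient.mk _ (C c) : A) • ι v := by
          rw [Algebra.smul_def (A := K), hmk, algHom_C, Algebra.smul_def, map_mul]
          rfl
        rw [h1]
        exact M.smul_mem _ hv'
    have hN' : ∀ v : S, v.IsHomogeneous N → x * ι v ∈ M := fun v hv => by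
      have hv' : v ∈ idealOfVars (Fin (n + 1)) ℂ ^ N := by
        rw [mem_pow_idealOfVars_iff]
        intro m hm
        exact (hv.degree_eq_sum_deg_support hm).le
      obtain ⟨a, ha, -, hsum⟩ :=
        exists_homogeneous_coeff_of_mem_span hφ.quadratic (hv.mul hQ2) (hN v hv')
      have h1 : x * ι v = ∑ j, (Ideal.Quotient.mk _ (X j) : A) • ι (a j) := by
        have h2 : x * ι v = (f i)⁻¹ * ι (v * Q) := by
          rw [map_mul]
          ring
        rw [h2, hsum, map_sum, Finset.mul_sum]
        refine Finset.sum_congr rfl fun j _ => ?_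
        rw [Algebra.smul_def (A := K), hmk, aeval_X, map_mul]
        ring
      rw [h1]
      exact M.sum_mem fun j _ => M.smul_mem _ (hM _ (by simpa using ha j))
    refine isIntegral_of_smul_mem_submodule M ?_ (Submodule.fg_span (t.finite_toSet.image _)) x ?_
    · refine (Submodule.ne_bot_iff _).2 ⟨ι (X k ^ N), hM _ (isHomogeneous_X_pow _ _), ?_⟩
      rw [ne_eq, map_eq_zero_iff ι hι]
      exact pow_ne_zero _ hXk
    · intro v hv
      induction hv using Submodule.span_induction with
      | mem v hv =>
        obtain ⟨u, hu, rfl⟩ := hv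
        exact hN' u (htN u hu)
      | zero => rw [smul_zero]; exact M.zero_mem
      | add u v _ _ hu hv => rw [smul_add]; exact M.add_mem hu hv
      | smul c v _ hv => rw [smul_comm]; exact M.smul_mem _ hv
  obtain ⟨y, hy⟩ := exists_algebraMap_eq_of_isIntegral hb hab hx
  obtain ⟨P, rfl⟩ := Ideal.Quotient.mk_surjective y
  obtain ⟨D, P', hP', hd⟩ := exists_homogenization i P
  have h1 : ψ P' = x := by
    rw [← hy, hmk, eq_comm, ← sub_eq_zero, ← map_sub]
    have : P - P' ∈ RingHom.ker ψ := hkerψ ▸ Ideal.span_mono (by simp) hd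
    exact this
  rw [hψ hP'] at h1
  refine ⟨D, X i * P', hι ?_⟩
  have h2 : ι (aeval F P') = f i ^ D * ((f i)⁻¹ * ι Q) := by
    change _ = f i ^ D * x
    rw [← h1, ← mul_assoc, ← mul_pow, mul_inv_cancel₀ hfi, one_pow, one_mul]
  change ι (aeval F (X i * P')) = _
  rw [map_mul, aeval_X, map_mul, h2, map_mul, map_pow]
  change f i * _ = f i ^ D * _
  linear_combination f i ^ D * ι Q * mul_inv_cancel₀ hfi

/-- The linear system of the map is complete: a quadric that contains the base scheme is a linear
combination of the forms defining the map. This is where normality of the image is used. -/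
theorem IsQuadraticBirational.mem_span_of_mem_saturation (hφ : IsQuadraticBirational F G)
    {Q : MvPolynomial (Fin (n + 1)) ℂ} (hQ2 : Q.IsHomogeneous 2)
    (hQ : Q ∈ saturation (baseIdeal F)) : Q ∈ Submodule.span ℂ (Set.range F) := by
  obtain ⟨m, rfl⟩ := Nat.exists_eq_add_of_lt hφ.pos
  obtain ⟨a, ha⟩ := hφ.exists_pow_mul_mem_range hQ2 hQ 0
  obtain ⟨b, hb⟩ := hφ.exists_pow_mul_mem_range hQ2 hQ 1
  obtain ⟨c, hc⟩ := hφ.exists_pow_mul_mem_range hQ2 hQ (Fin.last _)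
  obtain ⟨P, hP⟩ := mem_range_aeval_of_three_pow_mul_mem hφ.irreducible.ne_zero hφ.image
    (i := 0) (j := 1) (k := Fin.last _) (by simp) (by simp [Fin.ext_iff])
    (by simp [Fin.ext_iff]) (hφ.ne_zero 0) _ a b c le_rfl Q ha hb hc
  replace hP : aeval F P = Q := hP
  have h1 := homogeneousComponent_aeval two_pos hφ.quadratic P 1
  rw [hP, mul_one, homogeneousComponent_eq_self hQ2] at h1
  rw [h1]
  exact aeval_mem_span_of_isHomogeneous_one (homogeneousComponent_isHomogeneous _ _) F

end Completeness

/-! ### The system of quadrics through a quadric of codimension two -/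

section AdaptedCoordinates

variable {n : ℕ} {F : Fin (n + 2) → MvPolynomial (Fin (n + 1)) ℂ}
  {G : MvPolynomial (Fin (n + 2)) ℂ} {l q : MvPolynomial (Fin (n + 1)) ℂ}

lemma linearIndependent_mul_X {σ : Type*} {l : MvPolynomial σ ℂ} (h0 : l ≠ 0) :
    LinearIndependent ℂ fun j => l * X j := by
  exact (linearIndependent_X σ ℂ).map' (LinearMap.mulLeft ℂ l)
    (LinearMap.ker_eq_bot.2 (mul_right_injective₀ h0))

lemma exists_eq_mul_of_mem_span {z : MvPolynomial (Fin (n + 1)) ℂ}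
    (hz : z ∈ Submodule.span ℂ (Set.range fun j => l * X j)) :
    ∃ m : MvPolynomial (Fin (n + 1)) ℂ, m.IsHomogeneous 1 ∧ z = l * m := by
  obtain ⟨m, hm, rfl⟩ := exists_isHomogeneous_one_of_mem_span hz
  exact ⟨m, hm, by rw [aeval_mul_of_isHomogeneous hm, pow_one, aeval_X_left_apply]⟩

/-- If the base scheme lies in the hyperplane `l = 0` and in the quadric `q = 0`, then the products
of `l` with the coordinates, together with `q`, span the linear system: they lie in it by
completeness, and there are enough of them. -/
lemma IsQuadraticBirational.exists_eq_smul_add_mul (hφ : IsQuadraticBirational F G)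
    (hl1 : l.IsHomogeneous 1) (hl0 : l ≠ 0) (hl : l ∈ saturation (baseIdeal F))
    (hq2 : q.IsHomogeneous 2) (hq : q ∈ saturation (baseIdeal F)) (hlq : ¬ l ∣ q)
    (i : Fin (n + 2)) :
    ∃ (a : ℂ) (m : MvPolynomial (Fin (n + 1)) ℂ), m.IsHomogeneous 1 ∧ F i = a • q + l * m := by
  have hind : LinearIndependent ℂ
      (Fin.snoc (fun j => l * X j) q : Fin (n + 2) → MvPolynomial (Fin (n + 1)) ℂ) := by
    refine (linearIndependent_mul_X hl0).finSnoc fun h => hlq ?_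
    obtain ⟨m, -, hm⟩ := exists_eq_mul_of_mem_span h
    exact ⟨m, hm⟩
  have hle : Submodule.span ℂ (Set.range
      (Fin.snoc (fun j => l * X j) q : Fin (n + 2) → MvPolynomial (Fin (n + 1)) ℂ))
      ≤ Submodule.span ℂ (Set.range F) := by
    rw [Fin.range_snoc, Submodule.span_le, Set.insert_subset_iff]
    refine ⟨hφ.mem_span_of_mem_saturation hq2 hq, ?_⟩
    rintro _ ⟨j, rfl⟩
    exact hφ.mem_span_of_mem_saturation (hl1.mul (isHomogeneous_X _ j))
      (Ideal.mul_mem_right _ _ hl)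
  have := FiniteDimensional.span_of_finite ℂ (Set.finite_range F)
  have heq := Submodule.eq_of_le_of_finrank_eq hle (by
    rw [finrank_span_eq_card hind, finrank_span_eq_card hφ.linearIndependent])
  have hi : F i ∈ Submodule.span ℂ (Set.range F) := Submodule.subset_span ⟨i, rfl⟩
  rw [← heq, Fin.range_snoc, Submodule.mem_span_insert] at hi
  obtain ⟨a, z, hz, h⟩ := hi
  obtain ⟨m, hm, rfl⟩ := exists_eq_mul_of_mem_span hz
  exact ⟨a, m, hm, h⟩

/-- A nonzero linear form through the base scheme exhibits it as a quadric of codimension two. -/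
lemma IsQuadraticBirational.isCodimTwoQuadric (hφ : IsQuadraticBirational F G)
    (hl1 : l.IsHomogeneous 1) (hl0 : l ≠ 0) (hl : l ∈ saturation (baseIdeal F)) :
    IsCodimTwoQuadric (baseIdeal F) := by
  obtain ⟨i, hi⟩ : ∃ i, ¬ l ∣ F i := by
    by_contra! h
    exact not_isUnit_of_isHomogeneous one_pos hl1 (hφ.no_fixed_component l h)
  have hFi : F i ∈ saturation (baseIdeal F) := le_saturation _ (Ideal.subset_span ⟨i, rfl⟩)
  refine ⟨l, F i, hl1, hl0, hφ.quadratic i, hi, sameSubscheme_of_le ?_ ?_⟩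
  · rw [baseIdeal, Ideal.span_le]
    rintro _ ⟨k, rfl⟩
    obtain ⟨a, m, -, h⟩ := hφ.exists_eq_smul_add_mul hl1 hl0 hl (hφ.quadratic i) hFi hi k
    rw [SetLike.mem_coe, h, Algebra.smul_def, mul_comm l]
    exact add_mem (Ideal.mul_mem_left _ _ (Ideal.subset_span (by simp)))
      (Ideal.mul_mem_left _ _ (Ideal.subset_span (by simp)))
  · rw [Ideal.span_le, Set.insert_subset_iff, Set.singleton_subset_iff]
    exact ⟨hl, hFi⟩

/-- The linear forms `H j` and `Z` on the target of the map pull back to `l` times the coordinates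
and to `q`. They are coordinates on the target, in which the map is `x ↦ [l x : q]`. -/
structure IsAdaptedCoordinates (F : Fin (n + 2) → MvPolynomial (Fin (n + 1)) ℂ)
    (l q : MvPolynomial (Fin (n + 1)) ℂ) (H : Fin (n + 1) → MvPolynomial (Fin (n + 2)) ℂ)
    (Z : MvPolynomial (Fin (n + 2)) ℂ) : Prop where
  linear : ∀ j, (H j).IsHomogeneous 1
  linear_last : Z.IsHomogeneous 1
  pullback : ∀ j, aeval F (H j) = l * X j
  pullback_last : aeval F Z = q

lemma IsQuadraticBirational.exists_isAdaptedCoordinates (hφ : IsQuadraticBirational F G)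
    (hl1 : l.IsHomogeneous 1) (hl : l ∈ saturation (baseIdeal F))
    (hq2 : q.IsHomogeneous 2) (hq : q ∈ saturation (baseIdeal F)) :
    ∃ H Z, IsAdaptedCoordinates F l q H Z := by
  have h : ∀ j, ∃ L : MvPolynomial (Fin (n + 2)) ℂ, L.IsHomogeneous 1 ∧ aeval F L = l * X j :=
    fun j => exists_isHomogeneous_one_of_mem_span (hφ.mem_span_of_mem_saturation
      (hl1.mul (isHomogeneous_X _ j)) (Ideal.mul_mem_right _ _ hl))
  choose H hH1 hH2 using h
  obtain ⟨Z, hZ1, hZ2⟩ := exists_isHomogeneous_one_of_mem_span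
    (hφ.mem_span_of_mem_saturation hq2 hq)
  exact ⟨H, Z, hH1, hZ1, hH2, hZ2⟩

lemma IsAdaptedCoordinates.aeval_aeval {H : Fin (n + 1) → MvPolynomial (Fin (n + 2)) ℂ}
    {Z : MvPolynomial (Fin (n + 2)) ℂ} (h : IsAdaptedCoordinates F l q H Z)
    {P : MvPolynomial (Fin (n + 1)) ℂ} {e : ℕ} (hP : P.IsHomogeneous e) :
    aeval F (aeval H P) = l ^ e * P := by
  rw [← AlgHom.comp_apply, comp_aeval]
  simp only [h.pullback]
  rw [aeval_mul_of_isHomogeneous hP, aeval_X_left_apply]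

/-- The linear forms `H j` define the inverse map. -/
lemma IsAdaptedCoordinates.isInverse (hφ : IsQuadraticBirational F G) (hl0 : l ≠ 0)
    {H : Fin (n + 1) → MvPolynomial (Fin (n + 2)) ℂ}
    {Z : MvPolynomial (Fin (n + 2)) ℂ} (h : IsAdaptedCoordinates F l q H Z) :
    IsInverse F G 1 H := by
  have hmem : ∀ P : MvPolynomial (Fin (n + 2)) ℂ, P ∈ Ideal.span {G} ↔ aeval F P = 0 :=
    fun P => by rw [← hφ.image]; rfl
  refine ⟨h.linear, ⟨⟨0, ?_⟩, ⟨0, ?_⟩, fun i j => ?_⟩, ⟨⟨0, ?_⟩, ⟨0, ?_⟩, fun i j => ?_⟩⟩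
  · dsimp only
    rw [Ideal.mem_bot, h.pullback]
    exact mul_ne_zero hl0 (X_ne_zero _)
  · rw [Ideal.mem_bot]
    exact X_ne_zero _
  · dsimp only
    rw [Ideal.mem_bot, h.pullback, h.pullback]
    ring
  · dsimp only
    rw [hmem, h.aeval_aeval (hφ.quadratic 0)]
    exact mul_ne_zero (pow_ne_zero _ hl0) (hφ.ne_zero 0)
  · rw [hmem, aeval_X]
    exact hφ.ne_zero 0
  · rw [hmem, map_sub, map_mul, map_mul, h.aeval_aeval (hφ.quadratic i),
      h.aeval_aeval (hφ.quadratic j), aeval_X, aeval_X]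
    ring

/-- The inverse is not given by constants, since the source is not a point. -/
lemma IsQuadraticBirational.isOfTypeTwo_one (hφ : IsQuadraticBirational F G) (hl0 : l ≠ 0)
    {H : Fin (n + 1) → MvPolynomial (Fin (n + 2)) ℂ}
    {Z : MvPolynomial (Fin (n + 2)) ℂ} (h : IsAdaptedCoordinates F l q H Z) :
    IsOfTypeTwo F G 1 := by
  refine ⟨⟨H, h.isInverse hφ hl0⟩, ?_⟩
  rintro d ⟨H', hH'⟩
  by_contra hd
  obtain rfl : d = 0 := by omega
  obtain ⟨i, hi⟩ := hH'.left_inv.1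
  have : Nontrivial (Fin (n + 1)) := Fin.nontrivial_iff_two_le.2 (by have := hφ.pos; omega)
  obtain ⟨j, hj⟩ := exists_ne i
  have hc : ∀ k, ∃ c : ℂ, aeval F (H' k) = C c := fun k => by
    have := hH'.homogeneous k
    rw [← totalDegree_zero_iff_isHomogeneous, totalDegree_eq_zero_iff_eq_C] at this
    exact ⟨_, by rw [this, algHom_C]; rfl⟩
  obtain ⟨a, ha⟩ := hc i
  obtain ⟨b, hb⟩ := hc j
  have h1 := hH'.left_inv.2.2 i j
  dsimp only at h1 hi
  rw [Ideal.mem_bot, ha, hb] at h1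
  have h2 := congrArg (coeff (Finsupp.single j 1)) h1
  rw [coeff_sub, coeff_C_mul, coeff_C_mul, coeff_X, coeff_X, if_pos rfl,
    if_neg (fun h => hj ((Finsupp.single_left_inj one_ne_zero).1 h).symm)] at h2
  simp only [mul_one, mul_zero, sub_zero, coeff_zero] at h2
  rw [Ideal.mem_bot, ha, h2] at hi
  simp at hi

/-- If the inverse is given by linear forms, then the quadrics that they pull back to are the
products of the coordinates with a linear form, which vanishes on the base scheme. -/
lemma IsQuadraticBirational.exists_linear_of_isInverse (hφ : IsQuadraticBirational F G)
    {H : Fin (n + 1) → MvPolynomial (Fin (n + 2)) ℂ} (hH : IsInverse F G 1 H) :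
    ∃ l : MvPolynomial (Fin (n + 1)) ℂ,
      l.IsHomogeneous 1 ∧ l ∈ saturation (baseIdeal F) ∧ l ≠ 0 := by
  have : Nontrivial (Fin (n + 1)) := Fin.nontrivial_iff_two_le.2 (by have := hφ.pos; omega)
  have hrel : ∀ i j, aeval F (H i) * X j = aeval F (H j) * X i := fun i j => by
    have := hH.left_inv.2.2 i j
    rw [Ideal.mem_bot] at this
    linear_combination this
  obtain ⟨i, hi⟩ := hH.left_inv.1
  rw [Ideal.mem_bot] at hi
  obtain ⟨j, hj⟩ := exists_ne i
  have hprime : Prime (X i : MvPolynomial (Fin (n + 1)) ℂ) :=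
    (irreducible_of_isHomogeneous_one (isHomogeneous_X ℂ i) (X_ne_zero i)).prime
  obtain ⟨l, hl⟩ : (X i : MvPolynomial (Fin (n + 1)) ℂ) ∣ aeval F (H i) :=
    (hprime.dvd_or_dvd ⟨_, (hrel i j).trans (mul_comm _ _)⟩).resolve_right
      fun h => hj (X_dvd_X.1 h).symm
  have hl' : ∀ k, aeval F (H k) = X k * l := fun k => by
    refine mul_right_cancel₀ (X_ne_zero i : (X i : MvPolynomial (Fin (n + 1)) ℂ) ≠ 0) ?_
    rw [← hrel i k, hl]
    ring
  have hl0 : l ≠ 0 := by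
    rintro rfl
    exact hi (by simpa using hl)
  have hdeg : (X i * l).IsHomogeneous 2 := by
    have := (hH.homogeneous i).aeval F hφ.quadratic
    rwa [hl] at this
  refine ⟨l, ?_, fun k => ⟨1, ?_⟩, hl0⟩
  · have h1 : homogeneousComponent 2 (l * X i) = homogeneousComponent 1 l * X i := by
      rw [homogeneousComponent_mul_of_isHomogeneous (isHomogeneous_X ℂ i), if_pos one_le_two]
    have h2 : l * X i = homogeneousComponent 1 l * X i := by
      rw [← h1, mul_comm l, homogeneousComponent_eq_self hdeg]
    have h3 : l = homogeneousComponent 1 l :=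
      mul_right_cancel₀ (X_ne_zero i : (X i : MvPolynomial (Fin (n + 1)) ℂ) ≠ 0) h2
    rw [h3]
    exact homogeneousComponent_isHomogeneous _ _
  · rw [pow_one, ← hl' k, baseIdeal]
    exact Submodule.span_le_restrictScalars ℂ _ _
      (aeval_mem_span_of_isHomogeneous_one (hH.homogeneous k) F)

end AdaptedCoordinates

/-! ### Linear and quadratic forms as functions -/

/-- The linear functional given by the degree one part of a polynomial. -/
noncomputable def linearPart {m : ℕ} (l : MvPolynomial (Fin m) ℂ) : (Fin m → ℂ) →ₗ[ℂ] ℂ :=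
  ∑ i, coeff (Finsupp.single i 1) l • LinearMap.proj (R := ℂ) (φ := fun _ => ℂ) i

lemma linearPart_apply {m : ℕ} {l : MvPolynomial (Fin m) ℂ} (hl : l.IsHomogeneous 1)
    (u : Fin m → ℂ) : linearPart l u = eval u l := by
  obtain ⟨c, hc⟩ := (Submodule.mem_span_range_iff_exists_fun ℂ).1
    (aeval_mem_span_of_isHomogeneous_one hl (X : Fin m → MvPolynomial (Fin m) ℂ))
  rw [aeval_X_left_apply] at hc
  have h : ∀ i, coeff (Finsupp.single i 1) l = c i := fun i => by
    rw [← hc, coeff_sum]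
    simp [coeff_X, Finsupp.single_left_inj]
  simp only [linearPart, LinearMap.sum_apply, LinearMap.smul_apply, LinearMap.proj_apply, h]
  rw [← hc, map_sum]
  simp

lemma eval_add_of_isHomogeneous_one {m : ℕ} {l : MvPolynomial (Fin m) ℂ}
    (hl : l.IsHomogeneous 1) (u v : Fin m → ℂ) : eval (u + v) l = eval u l + eval v l := by
  simp only [← linearPart_apply hl, map_add]

lemma mem_hyperplane {m : ℕ} {l : MvPolynomial (Fin m) ℂ} (hl : l.IsHomogeneous 1)
    {u : Fin m → ℂ} : u ∈ hyperplane l ↔ eval u l = 0 := by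
  rw [← linearPart_apply hl]
  rfl

lemma linearPart_ne_zero {m : ℕ} {l : MvPolynomial (Fin m) ℂ} (hl : l.IsHomogeneous 1)
    (h0 : l ≠ 0) : linearPart l ≠ 0 := fun h => h0 <| by
  refine MvPolynomial.funext fun u => ?_
  rw [← linearPart_apply hl, h, map_zero, LinearMap.zero_apply]

lemma eval_aeval {σ τ : Type*} (u : τ → ℂ) (H : σ → MvPolynomial τ ℂ) (P : MvPolynomial σ ℂ) :
    eval u (aeval H P) = eval (fun j => eval u (H j)) P := by
  have h := (aeval u : MvPolynomial τ ℂ →ₐ[ℂ] ℂ).comp_apply (aeval H) P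
  rw [comp_aeval] at h
  exact h.symm

/-- The polar form as a second difference. -/
lemma toBilin'_hessian_apply {m : ℕ} {q : MvPolynomial (Fin m) ℂ} (hq : q.IsHomogeneous 2)
    (u v : Fin m → ℂ) :
    Matrix.toBilin' (hessian q) u v = eval (u + v) q - eval u q - eval v q := by
  have h : q ∈ homogeneousSubmodule (Fin m) ℂ 1 ^ 2 := by
    rw [homogeneousSubmodule_one_pow]
    exact hq
  have hadd : ∀ p r : MvPolynomial (Fin m) ℂ, hessian (p + r) = hessian p + hessian r :=
    fun p r => by ext i j; simp [hessian]
  have hsmul : ∀ (c : ℂ) (p : MvPolynomial (Fin m) ℂ), hessian (c • p) = c • hessian p :=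
    fun p r => by ext i j; simp [hessian]
  rw [homogeneousSubmodule_one_eq_span_X, pow_two, Submodule.span_mul_span] at h
  clear hq
  induction h using Submodule.span_induction with
  | mem q hq =>
    obtain ⟨_, ⟨a, rfl⟩, _, ⟨b, rfl⟩, rfl⟩ := hq
    have hh : ∀ i j, hessian (X a * X b) i j
        = (if i = a then 1 else 0) * (if j = b then 1 else 0)
          + (if i = b then 1 else 0) * (if j = a then 1 else 0) := fun i j => by
      have hp : ∀ s t : Fin m, pderiv s (X t : MvPolynomial (Fin m) ℂ)
          = if s = t then 1 else 0 := fun s t => by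
        rw [pderiv_X, Pi.single_apply]
        simp only [eq_comm]
      simp only [hessian, Matrix.of_apply, Derivation.leibniz, hp, smul_eq_mul, map_add]
      split_ifs <;> simp [*]
    rw [Matrix.toBilin'_apply]
    simp only [hh, mul_add, add_mul, Finset.sum_add_distrib]
    simp
    ring
  | zero =>
    have : hessian (0 : MvPolynomial (Fin m) ℂ) = 0 := by ext i j; simp [hessian]
    simp [this]
  | add p r _ _ hp hr =>
    rw [hadd, map_add, LinearMap.add_apply, LinearMap.add_apply, hp, hr]
    simp only [map_add]
    ring
  | smul c p _ hp =>
    rw [hsmul, map_smul, LinearMap.smul_apply, LinearMap.smul_apply, hp]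
    simp only [smul_eval, smul_eq_mul]
    ring

/-- The radical of the restriction of the polar form of `q` to `W`. -/
noncomputable def radicalOn {m : ℕ} (q : MvPolynomial (Fin m) ℂ) (W : Submodule ℂ (Fin m → ℂ)) :
    Submodule ℂ (Fin m → ℂ) :=
  (LinearMap.ker (LinearMap.BilinForm.restrict (Matrix.toBilin' (hessian q)) W)).map W.subtype

lemma mem_radicalOn {m : ℕ} {q : MvPolynomial (Fin m) ℂ} {W : Submodule ℂ (Fin m → ℂ)}
    {u : Fin m → ℂ} :
    u ∈ radicalOn q W ↔ u ∈ W ∧ ∀ v ∈ W, Matrix.toBilin' (hessian q) u v = 0 := by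
  simp only [radicalOn, Submodule.mem_map, LinearMap.mem_ker]
  constructor
  · rintro ⟨y, hy, rfl⟩
    exact ⟨y.2, fun v hv => LinearMap.congr_fun hy ⟨v, hv⟩⟩
  · rintro ⟨hu, h⟩
    exact ⟨⟨u, hu⟩, LinearMap.ext fun v => h v v.2, rfl⟩

lemma rankOn_add_finrank_radicalOn {m : ℕ} (q : MvPolynomial (Fin m) ℂ)
    (W : Submodule ℂ (Fin m → ℂ)) :
    rankOn q W + Module.finrank ℂ (radicalOn q W) = Module.finrank ℂ W := by
  rw [rankOn, radicalOn, Submodule.finrank_map_subtype_eq]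
  exact LinearMap.finrank_range_add_finrank_ker _

/-! ### The equation of the image and its rank -/

section Rank

variable {n : ℕ} {F : Fin (n + 2) → MvPolynomial (Fin (n + 1)) ℂ}
  {G : MvPolynomial (Fin (n + 2)) ℂ} {l q : MvPolynomial (Fin (n + 1)) ℂ}
  {H : Fin (n + 1) → MvPolynomial (Fin (n + 2)) ℂ} {Z : MvPolynomial (Fin (n + 2)) ℂ}

/-- The values of the adapted coordinates at the points of the affine cone over the target. -/
noncomputable def adaptedMap (H : Fin (n + 1) → MvPolynomial (Fin (n + 2)) ℂ)
    (Z : MvPolynomial (Fin (n + 2)) ℂ) :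
    (Fin (n + 2) → ℂ) →ₗ[ℂ] (Fin (n + 1) → ℂ) × ℂ :=
  (LinearMap.pi fun j => linearPart (H j)).prod (linearPart Z)

/-- The adapted coordinates separate points, since each coordinate `y i` of the target is a linear
combination of them: `F i = a q + l m` gives `y i = a Z + m(H)`. -/
lemma IsAdaptedCoordinates.bijective (hφ : IsQuadraticBirational F G)
    (hl1 : l.IsHomogeneous 1) (hl0 : l ≠ 0) (hl : l ∈ saturation (baseIdeal F))
    (hq2 : q.IsHomogeneous 2) (hq : q ∈ saturation (baseIdeal F)) (hlq : ¬ l ∣ q)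
    (h : IsAdaptedCoordinates F l q H Z) :
    Function.Bijective (adaptedMap H Z) := by
  have hinj : Function.Injective (adaptedMap H Z) := by
    rw [← LinearMap.ker_eq_bot, eq_bot_iff]
    intro u hu
    rw [LinearMap.mem_ker] at hu
    have hH : ∀ j, eval u (H j) = 0 := fun j => by
      rw [← linearPart_apply (h.linear j)]
      exact congrFun (congrArg Prod.fst hu) j
    have hZ : eval u Z = 0 := by
      rw [← linearPart_apply h.linear_last]
      exact congrArg Prod.snd hu
    rw [Submodule.mem_bot]
    ext i
    obtain ⟨a, m, hm, hF⟩ := hφ.exists_eq_smul_add_mul hl1 hl0 hl hq2 hq hlq i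
    have h1 : X i - (C a * Z + aeval H m) = 0 := by
      refine hφ.eq_zero_of_aeval_eq_zero (((isHomogeneous_X _ _).sub
        ((h.linear_last.C_mul a).add ?_))) ?_
      · exact hm.aeval H h.linear
      · rw [map_sub, map_add, map_mul, h.aeval_aeval hm, h.pullback_last, aeval_X, hF, algHom_C,
          Algebra.smul_def, pow_one]
        ring
    have h2 := congrArg (eval u) h1
    have h3 : eval u (aeval H m) = 0 := by
      have h4 : (fun j => eval u (H j)) = 0 := funext hH
      rw [eval_aeval, h4, ← linearPart_apply hm, map_zero]
    rw [map_sub, map_add, map_mul, h3, hZ, eval_X, map_zero] at h2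
    simpa using h2
  refine ⟨hinj, (LinearMap.injective_iff_surjective_of_finrank_eq_finrank ?_).1 hinj⟩
  simp

/-- The image is the quadric `q(H) = l(H) Z`: this equation holds on the image, it is not
identically zero, and no equation of degree less than two holds on the image. -/
lemma IsAdaptedCoordinates.exists_smul_eq (hφ : IsQuadraticBirational F G)
    (hl1 : l.IsHomogeneous 1) (hl0 : l ≠ 0) (hq2 : q.IsHomogeneous 2)
    (h : IsAdaptedCoordinates F l q H Z) (hbij : Function.Bijective (adaptedMap H Z)) :
    G.IsHomogeneous 2 ∧ ∃ c : ℂ, c ≠ 0 ∧ aeval H q - aeval H l * Z = c • G := by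
  have hG'2 : (aeval H q - aeval H l * Z).IsHomogeneous 2 :=
    (hq2.aeval H h.linear).sub ((hl1.aeval H h.linear).mul h.linear_last)
  have hG'0 : aeval H q - aeval H l * Z ≠ 0 := by
    obtain ⟨x, hx⟩ : ∃ x, eval x l ≠ 0 := by
      by_contra! hx
      exact hl0 (MvPolynomial.funext fun x => by rw [hx, map_zero])
    obtain ⟨u, hu⟩ := hbij.2 (x, (eval x q - 1) / eval x l)
    have hH : (fun j => eval u (H j)) = x := by
      ext1 j
      rw [← linearPart_apply (h.linear j)]
      exact congrFun (congrArg Prod.fst hu) j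
    have hZ : eval u Z = (eval x q - 1) / eval x l := by
      rw [← linearPart_apply h.linear_last]
      exact congrArg Prod.snd hu
    intro h0
    have h1 := congrArg (eval u) h0
    rw [map_sub, map_mul, eval_aeval, eval_aeval, hH, hZ, mul_div_cancel₀ _ hx, map_zero] at h1
    simp at h1
  have hmem : aeval H q - aeval H l * Z ∈ Ideal.span {G} := by
    rw [← hφ.image]
    change aeval F (aeval H q - aeval H l * Z) = 0
    rw [map_sub, map_mul, h.aeval_aeval hq2, h.aeval_aeval hl1, h.pullback_last]
    ring
  obtain ⟨c, hc⟩ := Ideal.mem_span_singleton.1 hmem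
  obtain ⟨e, he, hGe⟩ := hφ.nonlinear
  have hc0 : c ≠ 0 := by
    rintro rfl
    exact hG'0 (by rw [hc, mul_zero])
  have hdeg := totalDegree_mul_of_isDomain hφ.irreducible.ne_zero hc0
  rw [← hc, hG'2.totalDegree hG'0, hGe.totalDegree hφ.irreducible.ne_zero] at hdeg
  obtain rfl : e = 2 := by omega
  have hcC := totalDegree_eq_zero_iff_eq_C.1 (by omega : c.totalDegree = 0)
  refine ⟨hGe, coeff 0 c, fun h0 => hc0 ?_, ?_⟩
  · rw [hcC, h0, map_zero]
  · rw [hc, Algebra.smul_def, mul_comm]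
    nth_rewrite 1 [hcC]
    rfl

/-- In the adapted coordinates `(x, z)` the polar form of `q(x) - l(x) z` is
`B(x, y) - l(x) w - l(y) z`. Its radical consists of the `(x, z)` with `l(x) = 0` and
`B(x, ·) = z l`, and such a `z` exists, uniquely, when `x` is in the radical of `B` on `l = 0`. -/
lemma IsAdaptedCoordinates.finrank_radicalOn_eq
    (hl1 : l.IsHomogeneous 1) (hl0 : l ≠ 0) (hq2 : q.IsHomogeneous 2)
    (h : IsAdaptedCoordinates F l q H Z) (hbij : Function.Bijective (adaptedMap H Z))
    (hG2 : G.IsHomogeneous 2) {c : ℂ} (hc : c ≠ 0) (hG : aeval H q - aeval H l * Z = c • G) :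
    Module.finrank ℂ (radicalOn G ⊤) = Module.finrank ℂ (radicalOn q (hyperplane l)) := by
  have hH : ∀ u, (adaptedMap H Z u).1 = fun j => eval u (H j) := fun u => by
    ext1 j
    exact linearPart_apply (h.linear j) u
  have hZ : ∀ u, (adaptedMap H Z u).2 = eval u Z := fun u => linearPart_apply h.linear_last u
  have heval : ∀ u, c * eval u G = eval (adaptedMap H Z u).1 q
      - eval (adaptedMap H Z u).1 l * (adaptedMap H Z u).2 := fun u => by
    rw [hH, hZ, ← eval_aeval, ← eval_aeval, ← map_mul, ← map_sub, hG, smul_eval]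
  have hpolar : ∀ u v, c * Matrix.toBilin' (hessian G) u v
      = Matrix.toBilin' (hessian q) (adaptedMap H Z u).1 (adaptedMap H Z v).1
        - eval (adaptedMap H Z u).1 l * (adaptedMap H Z v).2
        - eval (adaptedMap H Z v).1 l * (adaptedMap H Z u).2 := fun u v => by
    rw [toBilin'_hessian_apply hG2, toBilin'_hessian_apply hq2, mul_sub, mul_sub, heval, heval,
      heval, map_add, Prod.fst_add, Prod.snd_add, eval_add_of_isHomogeneous_one hl1]
    ring
  obtain ⟨y₀, hy₀⟩ : ∃ y, eval y l ≠ 0 := by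
    by_contra! hx
    exact hl0 (MvPolynomial.funext fun x => by rw [hx, map_zero])
  have hrad : ∀ u, u ∈ radicalOn G ⊤ ↔ ∀ y w,
      Matrix.toBilin' (hessian q) (adaptedMap H Z u).1 y
        - eval (adaptedMap H Z u).1 l * w - eval y l * (adaptedMap H Z u).2 = 0 := fun u => by
    rw [mem_radicalOn]
    constructor
    · rintro ⟨-, hu⟩ y w
      obtain ⟨v, hv⟩ := hbij.2 (y, w)
      have h1 := hpolar u v
      rw [hu v trivial, hv, mul_zero] at h1
      exact h1.symm
    · intro hu
      refine ⟨trivial, fun v _ => (mul_eq_zero.1 ?_).resolve_left hc⟩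
      rw [hpolar]
      exact hu _ _
  let π : radicalOn G ⊤ →ₗ[ℂ] (Fin (n + 1) → ℂ) :=
    (LinearMap.fst ℂ _ _ ∘ₗ adaptedMap H Z).domRestrict (radicalOn G ⊤)
  have hπ : ∀ u, π u = (adaptedMap H Z u).1 := fun u => rfl
  have hinj : Function.Injective π := by
    rw [← LinearMap.ker_eq_bot, eq_bot_iff]
    rintro ⟨u, hu⟩ hu0
    rw [LinearMap.mem_ker, hπ] at hu0
    have h1 := (hrad u).1 hu y₀ 0
    rw [hu0, map_zero, LinearMap.zero_apply, mul_zero, sub_zero, zero_sub, neg_eq_zero] at h1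
    have h2 : adaptedMap H Z u = adaptedMap H Z 0 := by
      rw [map_zero]
      exact Prod.ext hu0 ((mul_eq_zero.1 h1).resolve_left hy₀)
    rw [Submodule.mem_bot]
    exact Subtype.ext (hbij.1 h2)
  have hrange : LinearMap.range π = radicalOn q (hyperplane l) := by
    ext x
    rw [mem_radicalOn, mem_hyperplane hl1]
    constructor
    · rintro ⟨⟨u, hu⟩, rfl⟩
      rw [hπ]
      have h1 := (hrad u).1 hu
      have h0 : eval 0 l = 0 := by rw [← linearPart_apply hl1, map_zero]
      refine ⟨by simpa [-eval_zero, h0] using h1 0 1, fun v hv => ?_⟩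
      rw [mem_hyperplane hl1] at hv
      simpa [hv] using h1 v 0
    · rintro ⟨hx, hB⟩
      obtain ⟨u, hu⟩ := hbij.2 (x, Matrix.toBilin' (hessian q) x y₀ / eval y₀ l)
      refine ⟨⟨u, (hrad u).2 fun y w => ?_⟩, ?_⟩
      · have h1 := hB (y - (eval y l / eval y₀ l) • y₀) (by
          rw [mem_hyperplane hl1, ← linearPart_apply hl1, map_sub, map_smul,
            linearPart_apply hl1, linearPart_apply hl1, smul_eq_mul,
            div_mul_cancel₀ _ hy₀, sub_self])
        rw [map_sub, map_smul, smul_eq_mul] at h1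
        simp only [hu, hx]
        linear_combination h1
      · rw [hπ]
        exact congrArg Prod.fst hu
  rw [← hrange, LinearMap.finrank_range_of_inj hinj]

lemma IsAdaptedCoordinates.rankOn_add_two (hφ : IsQuadraticBirational F G)
    (hl1 : l.IsHomogeneous 1) (hl0 : l ≠ 0) (hq2 : q.IsHomogeneous 2)
    (h : IsAdaptedCoordinates F l q H Z) (hbij : Function.Bijective (adaptedMap H Z)) :
    rankOn q (hyperplane l) + 2 = rankOn G ⊤ := by
  obtain ⟨hG2, c, hc, hG⟩ := h.exists_smul_eq hφ hl1 hl0 hq2 hbij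
  have h1 := rankOn_add_finrank_radicalOn G ⊤
  have h2 := rankOn_add_finrank_radicalOn q (hyperplane l)
  have h3 : Module.finrank ℂ (hyperplane l) + 1 = Module.finrank ℂ (Fin (n + 1) → ℂ) :=
    Module.Dual.finrank_ker_add_one_of_ne_zero (linearPart_ne_zero hl1 hl0)
  have h4 := h.finrank_radicalOn_eq hl1 hl0 hq2 hbij hG2 hc hG
  rw [Module.finrank_fin_fun] at h3
  rw [finrank_top, Module.finrank_fin_fun] at h1
  omega

end Rank

/-! ### Depth and associated primes in a Noetherian local ring -/

section Depth

open IsLocalRing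

variable {R : Type*} [CommRing R]

/-- The element `a` is a nonzerodivisor on `R ⧸ I`. -/
def IsRegularMod (I : Ideal R) (a : R) : Prop := ∀ u, a * u ∈ I → u ∈ I

/-- If `l` is regular modulo `I + (b)` and `b` is regular modulo `I`, then `b` is regular
modulo `I + (l)`. -/
lemma IsRegularMod.swap {I : Ideal R} {b l : R} (hb : IsRegularMod I b)
    (hl : IsRegularMod (I ⊔ Ideal.span {b}) l) : IsRegularMod (I ⊔ Ideal.span {l}) b := by
  intro u hu
  obtain ⟨i, hi, _, hv, h⟩ := Submodule.mem_sup.1 hu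
  obtain ⟨v, rfl⟩ := Ideal.mem_span_singleton.1 hv
  have h1 : l * v ∈ I ⊔ Ideal.span {b} := by
    rw [show l * v = -i + b * u by linear_combination h]
    exact Submodule.add_mem_sup (I.neg_mem hi) (Ideal.mem_span_singleton.2 ⟨u, rfl⟩)
  obtain ⟨j, hj, _, hw, h2⟩ := Submodule.mem_sup.1 (hl v h1)
  obtain ⟨w, rfl⟩ := Ideal.mem_span_singleton.1 hw
  have h3 : b * (u - l * w) ∈ I := by
    rw [show b * (u - l * w) = i + l * j by linear_combination -h - l * h2]
    exact I.add_mem hi (I.mul_mem_left _ hj)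
  rw [show u = (u - l * w) + l * w by ring]
  exact Submodule.add_mem_sup (hb _ h3) (Ideal.mem_span_singleton.2 ⟨w, rfl⟩)

/-- The annihilator of a nonzero element of `R ⧸ I` is contained in an associated prime. -/
lemma exists_isAssociatedPrime_of_notMem [IsNoetherianRing R] {I : Ideal R} {v : R} (hv : v ∉ I) :
    ∃ (q : Ideal R) (u : R), q.IsPrime ∧ (∀ x, x ∈ q ↔ x * u ∈ I) ∧ ∀ x, x * v ∈ I → x ∈ q := by
  obtain ⟨q, hq, hle⟩ := exists_le_isAssociatedPrime_of_isNoetherianRing R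
    (Ideal.Quotient.mk I v) (by rwa [ne_eq, Ideal.Quotient.eq_zero_iff_mem])
  obtain ⟨hp, u, hu⟩ := isAssociatedPrime_iff.1 hq
  obtain ⟨u, rfl⟩ := Ideal.Quotient.mk_surjective u
  have key : ∀ x w : R, x ∈ (⊥ : Submodule R (R ⧸ I)).colon {Ideal.Quotient.mk I w} ↔ x * w ∈ I :=
    fun x w => by
      rw [Submodule.mem_colon_singleton, Submodule.mem_bot, ← Ideal.Quotient.eq_zero_iff_mem,
        map_mul, Algebra.smul_def]
      rfl
  exact ⟨q, u, hp, fun x => by rw [hu, key], fun x hx => hle ((key x v).2 hx)⟩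

/-- The easy inequality between codimension and height. -/
lemma ringKrullDim_quotient_le_of_le_height (J : Ideal R) {c d : ℕ} (hc : (c : ℕ∞) ≤ J.height)
    (hR : ringKrullDim R ≤ (d + c : ℕ)) : ringKrullDim (R ⧸ J) ≤ d := by
  rw [ringKrullDim_quotient, Order.krullDim]
  refine iSup_le fun s => ?_
  have h : ∀ i : Fin (s.length + 1), ((i + c : ℕ) : ℕ∞) ≤ (s i).1.asIdeal.height := by
    intro i
    induction i using Fin.induction with
    | zero =>
      simp only [Fin.val_zero, zero_add]
      exact hc.trans (Ideal.height_mono (s 0).2)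
    | succ i ih =>
      have h1 := Ideal.height_add_one_le_of_lt_of_isPrime
        (show (s i.castSucc).1.asIdeal < (s i.succ).1.asIdeal from s.step i)
      refine le_trans ?_ h1
      refine le_trans (le_of_eq ?_) (add_le_add_left ih 1)
      simp only [Fin.val_succ, Fin.val_castSucc]
      push_cast
      ring
  have h1 := h (Fin.last _)
  have h2 : ((s.length + c : ℕ) : WithBot ℕ∞) ≤ (d + c : ℕ) := by
    refine le_trans ?_ ((Ideal.height_le_ringKrullDim_of_isPrime
      (I := (s (Fin.last _)).1.asIdeal)).trans hR)
    exact_mod_cast h1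
  norm_cast at h2 ⊢
  omega

variable [IsLocalRing R]

/-- The maximal ideal is not associated to `R ⧸ I`. -/
def HasNoSocle (I : Ideal R) : Prop := ∀ u, (∀ x ∈ maximalIdeal R, x * u ∈ I) → u ∈ I

lemma IsRegularMod.hasNoSocle {I : Ideal R} {a : R} (ha : IsRegularMod I a)
    (hm : a ∈ maximalIdeal R) : HasNoSocle I :=
  fun u hu => ha u (hu a hm)

/-- For `a` and `b` regular modulo `I`, multiplication by `a / b` identifies the socle of
`R ⧸ (I + (b))` with that of `R ⧸ (I + (a))`. -/
lemma HasNoSocle.exchange {I : Ideal R} {a b : R} (ha : IsRegularMod I a) (hb : IsRegularMod I b)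
    (ham : a ∈ maximalIdeal R) (h : HasNoSocle (I ⊔ Ideal.span {a})) :
    HasNoSocle (I ⊔ Ideal.span {b}) := by
  intro u hu
  obtain ⟨i, hi, _, hv, h1⟩ := Submodule.mem_sup.1 (hu a ham)
  obtain ⟨v, rfl⟩ := Ideal.mem_span_singleton.1 hv
  have hv : v ∈ I ⊔ Ideal.span {a} := by
    refine h v fun x hx => ?_
    obtain ⟨j, hj, _, hw, h2⟩ := Submodule.mem_sup.1 (hu x hx)
    obtain ⟨w, rfl⟩ := Ideal.mem_span_singleton.1 hw
    have h3 : b * (x * v - a * w) ∈ I := by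
      rw [show b * (x * v - a * w) = a * j - x * i by linear_combination x * h1 - a * h2]
      exact I.sub_mem (I.mul_mem_left _ hj) (I.mul_mem_left _ hi)
    rw [show x * v = (x * v - a * w) + a * w by ring]
    exact Submodule.add_mem_sup (hb _ h3) (Ideal.mem_span_singleton.2 ⟨w, rfl⟩)
  obtain ⟨j, hj, _, hw, h2⟩ := Submodule.mem_sup.1 hv
  obtain ⟨t, rfl⟩ := Ideal.mem_span_singleton.1 hw
  have h3 : a * (u - b * t) ∈ I := by
    rw [show a * (u - b * t) = i + b * j by linear_combination -h1 - b * h2]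
    exact I.add_mem hi (I.mul_mem_left _ hj)
  rw [show u = (u - b * t) + b * t by ring]
  exact Submodule.add_mem_sup (ha _ h3) (Ideal.mem_span_singleton.2 ⟨t, rfl⟩)

/-- By prime avoidance, finitely many ideals without socle have a common regular element. -/
lemma exists_isRegularMod [IsNoetherianRing R] (s : Finset (Ideal R))
    (hs : ∀ I ∈ s, HasNoSocle I) : ∃ l ∈ maximalIdeal R, ∀ I ∈ s, IsRegularMod I l := by
  have hfin : (⋃ I ∈ s, associatedPrimes R (R ⧸ I)).Finite :=
    s.finite_toSet.biUnion fun I _ => associatedPrimes.finite R (R ⧸ I)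
  have hnot : ¬ ((maximalIdeal R : Set R) ⊆
      ⋃ p ∈ ⋃ I ∈ s, associatedPrimes R (R ⧸ I), (p : Set R)) := by
    rw [Ideal.subset_union_prime_finite hfin ⊥ ⊥]
    · rintro ⟨p, hp, hle⟩
      simp only [Set.mem_iUnion] at hp
      obtain ⟨I, hI, hp⟩ := hp
      obtain ⟨hpp, u, hu⟩ := isAssociatedPrime_iff.1 hp
      obtain ⟨u, rfl⟩ := Ideal.Quotient.mk_surjective u
      have h1 : u ∈ I := by
        refine hs I hI u fun x hx => ?_
        have h2 := hle hx
        rw [hu, Submodule.mem_colon_singleton, Submodule.mem_bot] at h2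
        rw [← Ideal.Quotient.eq_zero_iff_mem, map_mul]
        exact h2
      refine hpp.ne_top ?_
      rw [hu, Ideal.Quotient.eq_zero_iff_mem.2 h1]
      simp
    · intro p hp _ _
      simp only [Set.mem_iUnion] at hp
      obtain ⟨I, hI, hp⟩ := hp
      exact hp.isPrime
  obtain ⟨l, hl, hl'⟩ := Set.not_subset.1 hnot
  refine ⟨l, hl, fun I hI u hu => ?_⟩
  by_contra hu'
  obtain ⟨q, hq, hle⟩ := exists_le_isAssociatedPrime_of_isNoetherianRing R
    (Ideal.Quotient.mk I u) (by rwa [ne_eq, Ideal.Quotient.eq_zero_iff_mem])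
  refine hl' ?_
  simp only [Set.mem_iUnion]
  refine ⟨q, ⟨I, hI, hq⟩, hle ?_⟩
  rw [Submodule.mem_colon_singleton, Submodule.mem_bot]
  rwa [← Ideal.Quotient.eq_zero_iff_mem, map_mul] at hu

/-- There is a regular sequence of length `d` on `R ⧸ I` in the maximal ideal. -/
def DepthGE : ℕ → Ideal R → Prop
  | 0, _ => True
  | d + 1, I => ∃ a ∈ maximalIdeal R, IsRegularMod I a ∧ DepthGE d (I ⊔ Ideal.span {a})

/-- Any regular element is the first element of a regular sequence of maximal length. -/
lemma DepthGE.sup_span_singleton [IsNoetherianRing R] {d : ℕ} {I : Ideal R} {b : R}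
    (h : DepthGE (d + 1) I) (hb : IsRegularMod I b) : DepthGE d (I ⊔ Ideal.span {b}) := by
  classical
  induction d generalizing I b with
  | zero => trivial
  | succ d ih =>
    obtain ⟨a, ham, ha, had⟩ := h
    have had' := had
    obtain ⟨a', ham', ha', -⟩ := had'
    have hs := ha'.hasNoSocle ham'
    -- `l` is regular modulo `I`, `I + (a)` and `I + (b)`, so that it can replace both `a` and `b`
    obtain ⟨l, hlm, hl⟩ := exists_isRegularMod {I, I ⊔ Ideal.span {a}, I ⊔ Ideal.span {b}} (by
      simp only [Finset.mem_insert, Finset.mem_singleton, forall_eq_or_imp, forall_eq]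
      exact ⟨ha.hasNoSocle ham, hs, hs.exchange ha hb ham⟩)
    simp only [Finset.mem_insert, Finset.mem_singleton, forall_eq_or_imp, forall_eq] at hl
    obtain ⟨hlI, hla, hlb⟩ := hl
    have h1 : DepthGE (d + 1) (I ⊔ Ideal.span {l}) :=
      ⟨a, ham, ha.swap hla, by rw [sup_right_comm]; exact ih had hla⟩
    exact ⟨l, hlm, hlb, by rw [sup_right_comm]; exact ih h1 (hb.swap hlb)⟩

/-- The depth of `R ⧸ I` is at most the dimension of `R ⧸ p`, for every associated prime `p`.
Indeed, if `a` is the first element of a regular sequence, then some associated prime of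
`R ⧸ (I + (a))` contains `p + (a)`, by Nakayama's lemma for the submodule killed by `p`. -/
lemma DepthGE.le_ringKrullDim_quotient [IsNoetherianRing R] {d : ℕ} {I : Ideal R}
    (h : DepthGE d I) {p : Ideal R} [p.IsPrime] {u : R} (hp : ∀ x, x ∈ p ↔ x * u ∈ I) :
    (d : WithBot ℕ∞) ≤ ringKrullDim (R ⧸ p) := by
  induction d generalizing I p u with
  | zero => exact ringKrullDim_nonneg_of_nontrivial
  | succ d ih =>
    obtain ⟨a, ham, ha, had⟩ := h
    have hu : u ∉ I := fun hu => (Ideal.ne_top_iff_one p).1 Ideal.IsPrime.ne_top'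
      ((hp 1).2 (by rwa [one_mul]))
    have hap : a ∉ p := fun h => hu (ha u ((hp a).1 h))
    let N : Ideal R := Submodule.colon I p
    have hN : ∀ v, v ∈ N ↔ ∀ x ∈ p, x * v ∈ I := fun v => by
      simp only [N, Submodule.mem_colon, smul_eq_mul, mul_comm v, SetLike.mem_coe]
    obtain ⟨v, hvN, hv⟩ : ∃ v ∈ N, v ∉ I ⊔ Ideal.span {a} := by
      by_contra! hle
      have h1 : N ≤ I ⊔ maximalIdeal R • N := by
        intro v hv
        obtain ⟨i, hi, _, hw, hiw⟩ := Submodule.mem_sup.1 (hle v hv)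
        obtain ⟨w, rfl⟩ := Ideal.mem_span_singleton.1 hw
        rw [← hiw]
        refine Submodule.add_mem_sup hi (Submodule.smul_mem_smul ham ((hN w).2 fun x hx => ha _ ?_))
        rw [show a * (x * w) = x * v - x * i by linear_combination x * hiw]
        exact I.sub_mem ((hN v).1 hv x hx) (I.mul_mem_left _ hi)
      have h2 := Submodule.le_of_le_smul_of_le_jacobson_bot (IsNoetherian.noetherian N)
        (maximalIdeal_le_jacobson ⊥) h1
      exact hu (h2 ((hN u).2 fun x hx => (hp x).1 hx))
    obtain ⟨q, w, hq, hqw, hqv⟩ := exists_isAssociatedPrime_of_notMem hv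
    have hpq : p ≤ q := fun x hx => hqv x (Ideal.mem_sup_left ((hN v).1 hvN x hx))
    have haq : a ∈ q := hqv a (Ideal.mem_sup_right (Ideal.mem_span_singleton.2 ⟨v, rfl⟩))
    have h1 := ih had hqw
    have h2 : ringKrullDim (R ⧸ q) + 1 ≤ ringKrullDim (R ⧸ p) :=
      ringKrullDim_succ_le_of_surjective (Ideal.Quotient.factor hpq)
        (Ideal.Quotient.factor_surjective hpq) (r := Ideal.Quotient.mk p a)
        (mem_nonZeroDivisors_of_ne_zero (by rwa [ne_eq, Ideal.Quotient.eq_zero_iff_mem]))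
        (by rwa [Ideal.Quotient.factor_mk, Ideal.Quotient.eq_zero_iff_mem])
    push_cast
    exact (add_le_add_left h1 1).trans h2

/-- An element that cuts down the dimension of a Cohen-Macaulay ring is regular. -/
lemma DepthGE.sup_span_singleton_of_ringKrullDim_le [IsNoetherianRing R] {d : ℕ} {I : Ideal R}
    {x : R} (h : DepthGE (d + 1) I) (hd : ringKrullDim (R ⧸ (I ⊔ Ideal.span {x})) ≤ d) :
    DepthGE d (I ⊔ Ideal.span {x}) := by
  refine h.sup_span_singleton fun u hu => ?_
  by_contra hu'
  obtain ⟨p, w, hp, hpw, hpu⟩ := exists_isAssociatedPrime_of_notMem hu'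
  have hle : I ⊔ Ideal.span {x} ≤ p := by
    rw [sup_le_iff, Ideal.span_singleton_le_iff_mem]
    exact ⟨fun y hy => hpu y (I.mul_mem_right _ hy), hpu x hu⟩
  have h1 := h.le_ringKrullDim_quotient hpw
  have h2 := ringKrullDim_le_of_surjective _ (Ideal.Quotient.factor_surjective hle)
  have h3 : ((d + 1 : ℕ) : WithBot ℕ∞) ≤ (d : ℕ) := h1.trans (h2.trans hd)
  norm_cast at h3
  omega

lemma ringKrullDim_quotient_le_sup_span_singleton_add_one [IsNoetherianRing R] (I : Ideal R) {x : R}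
    (hx : x ∈ maximalIdeal R) :
    ringKrullDim (R ⧸ I) ≤ ringKrullDim (R ⧸ (I ⊔ Ideal.span {x})) + 1 := by
  have h := ringKrullDim_le_ringKrullDim_quotient_add_encard (R := R ⧸ I) {Ideal.Quotient.mk I x} (by
    rw [Set.singleton_subset_iff, SetLike.mem_coe, Ring.jacobson_eq_sInf_isMaximal,
      Submodule.mem_sInf]
    intro (M : Ideal (R ⧸ I)) hM
    have : M.IsMaximal := hM
    have h1 := Ideal.comap_isMaximal_of_surjective (Ideal.Quotient.mk I)
      Ideal.Quotient.mk_surjective (K := M)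
    rw [← eq_maximalIdeal h1] at hx
    exact hx)
  rw [Set.encard_singleton, ← Set.image_singleton, ← Ideal.map_span] at h
  rwa [ringKrullDim_eq_of_ringEquiv (DoubleQuot.quotQuotEquivQuotSup I (Ideal.span {x}))] at h

lemma ringKrullDim_quotient_le_sup_ofList_add_length [IsNoetherianRing R] (I : Ideal R) (xs : List R)
    (hx : ∀ x ∈ xs, x ∈ maximalIdeal R) :
    ringKrullDim (R ⧸ I) ≤ ringKrullDim (R ⧸ (I ⊔ Ideal.ofList xs)) + xs.length := by
  induction xs generalizing I with
  | nil =>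
    rw [Ideal.ofList_nil, sup_bot_eq]
    simp
  | cons x xs ih =>
    rw [List.forall_mem_cons] at hx
    refine (ringKrullDim_quotient_le_sup_span_singleton_add_one I hx.1).trans ?_
    refine (add_le_add_left (ih (I ⊔ Ideal.span {x}) hx.2) 1).trans ?_
    rw [Ideal.ofList_cons, sup_assoc, List.length_cons, Nat.cast_succ, add_assoc]

/-- In a Cohen-Macaulay local ring, part of a system of parameters is a regular sequence. -/
lemma DepthGE.sup_ofList_of_ringKrullDim_le [IsNoetherianRing R] {d : ℕ} (xs : List R)
    (hx : ∀ x ∈ xs, x ∈ maximalIdeal R) {I : Ideal R} (h : DepthGE (d + xs.length) I)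
    (hd : ringKrullDim (R ⧸ (I ⊔ Ideal.ofList xs)) ≤ d) :
    DepthGE d (I ⊔ Ideal.ofList xs) := by
  induction xs generalizing I with
  | nil => simpa using h
  | cons x xs ih =>
    rw [List.forall_mem_cons] at hx
    rw [Ideal.ofList_cons, ← sup_assoc] at hd ⊢
    refine ih hx.2 (h.sup_span_singleton_of_ringKrullDim_le ?_) hd
    refine (ringKrullDim_quotient_le_sup_ofList_add_length _ xs hx.2).trans ?_
    exact add_le_add_left hd _

end Depth

/-! ### Complete intersections in projective space -/

section CompleteIntersection

open IsLocalRing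

variable {m : ℕ}

lemma idealOfVars_eq_ker_constantCoeff :
    idealOfVars (Fin m) ℂ = RingHom.ker (constantCoeff : MvPolynomial (Fin m) ℂ →+* ℂ) := by
  ext f
  rw [← pow_one (idealOfVars (Fin m) ℂ), mem_pow_idealOfVars_iff', RingHom.mem_ker,
    constantCoeff_eq]
  simp only [Nat.lt_one_iff, Finsupp.degree_eq_zero_iff, forall_eq]

instance isPrime_idealOfVars : (idealOfVars (Fin m) ℂ).IsPrime := by
  rw [idealOfVars_eq_ker_constantCoeff]
  exact RingHom.ker_isPrime _

lemma mem_primeCompl_idealOfVars_iff {f : MvPolynomial (Fin m) ℂ} :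
    f ∈ (idealOfVars (Fin m) ℂ).primeCompl ↔ constantCoeff f ≠ 0 := by
  change f ∉ idealOfVars (Fin m) ℂ ↔ _
  rw [idealOfVars_eq_ker_constantCoeff, RingHom.mem_ker]

/-- The local ring at the vertex of the affine cone over projective space. -/
abbrev VertexRing (m : ℕ) : Type := Localization.AtPrime (idealOfVars (Fin m) ℂ)

lemma ringKrullDim_vertexRing_le : ringKrullDim (VertexRing m) ≤ m := by
  rw [IsLocalization.AtPrime.ringKrullDim_eq_height (idealOfVars (Fin m) ℂ)]
  refine (Ideal.height_le_ringKrullDim_of_isPrime).trans ?_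
  rw [MvPolynomial.ringKrullDim_of_isNoetherianRing, ringKrullDim_eq_zero_of_field]
  simp

/-- The variables form a regular sequence at the vertex. -/
lemma depthGE_vertexRing : DepthGE m (⊥ : Ideal (VertexRing m)) := by
  have h : ∀ k ≤ m, DepthGE k ((Ideal.span (X '' {i : Fin m | k ≤ i})).map
      (algebraMap (MvPolynomial (Fin m) ℂ) (VertexRing m))) := by
    intro k
    induction k with
    | zero => exact fun _ => trivial
    | succ k ih =>
      intro hk
      refine ⟨algebraMap (MvPolynomial (Fin m) ℂ) (VertexRing m) (X (⟨k, hk⟩ : Fin m)), ?_,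
        fun u hu => ?_, ?_⟩
      · rw [IsLocalization.AtPrime.to_map_mem_maximal_iff (VertexRing m) (idealOfVars (Fin m) ℂ)]
        exact Ideal.subset_span (Set.mem_range_self _)
      · obtain ⟨a, s, rfl⟩ := IsLocalization.exists_mk'_eq (idealOfVars (Fin m) ℂ).primeCompl u
        rw [IsLocalization.mul_mk'_eq_mk'_of_mul, IsLocalization.mk'_mem_map_algebraMap_iff] at hu
        obtain ⟨t, ht, htu⟩ := hu
        rw [IsLocalization.mk'_mem_map_algebraMap_iff]
        rw [mul_left_comm] at htu
        exact ⟨t, ht, mem_span_X_of_X_mul_mem (by simp) htu⟩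
      · have h1 : {i : Fin m | k ≤ i} = {i : Fin m | k + 1 ≤ i} ∪ {⟨k, hk⟩} := by
          ext i
          simp only [Set.mem_ofPred_eq, Set.mem_union, Set.mem_singleton_iff, Fin.ext_iff]
          omega
        have h2 := ih (by omega)
        rwa [h1, Set.image_union, Ideal.span_union, Ideal.map_sup, Set.image_singleton,
          Ideal.map_span _ {_}, Set.image_singleton] at h2
  have h1 := h m le_rfl
  have h2 : {i : Fin m | m ≤ i} = ∅ := by
    ext i
    simp
  rwa [h2, Set.image_empty, Ideal.span_empty, Ideal.map_bot] at h1

variable {c : ℕ} {g : Fin c → MvPolynomial (Fin m) ℂ} {d : Fin c → ℕ}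

/-- A form that belongs to a homogeneous ideal at the vertex belongs to the ideal. -/
lemma mem_span_of_algebraMap_mem (hg : ∀ i, (g i).IsHomogeneous (d i))
    {f : MvPolynomial (Fin m) ℂ} {e : ℕ} (hf : f.IsHomogeneous e)
    (h : algebraMap _ (VertexRing m) f ∈ (Ideal.span (Set.range g)).map (algebraMap _ _)) :
    f ∈ Ideal.span (Set.range g) := by
  obtain ⟨t, ht, htf⟩ := (IsLocalization.algebraMap_mem_map_algebraMap_iff
    (idealOfVars (Fin m) ℂ).primeCompl (VertexRing m) _ _).1 h
  rw [mem_primeCompl_idealOfVars_iff] at ht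
  let _ : GradedAlgebra (homogeneousSubmodule (Fin m) ℂ) := MvPolynomial.gradedAlgebra
  have hhom : (Ideal.span (Set.range g)).IsHomogeneous (homogeneousSubmodule (Fin m) ℂ) := by
    refine Ideal.homogeneous_span _ _ ?_
    rintro _ ⟨i, rfl⟩
    exact ⟨d i, hg i⟩
  have h1 := homogeneousComponent_mem_of_mem hhom htf e
  rw [homogeneousComponent_mul_of_isHomogeneous hf, if_pos le_rfl, Nat.sub_self,
    homogeneousComponent_zero, ← constantCoeff_eq] at h1
  have h2 := Ideal.mul_mem_left _ (C (constantCoeff t)⁻¹) h1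
  rwa [← mul_assoc, ← C_mul, inv_mul_cancel₀ ht, C_1, one_mul] at h2

lemma le_height_map_vertexRing {c : ℕ} {I : Ideal (MvPolynomial (Fin m) ℂ)}
    (hI : (c : ℕ∞) ≤ I.height) :
    (c : ℕ∞) ≤ (I.map (algebraMap _ (VertexRing m))).height := by
  refine hI.trans ?_
  rw [← IsLocalization.height_under (idealOfVars (Fin m) ℂ).primeCompl (I.map _)]
  exact Ideal.height_mono Ideal.le_comap_map

/-- If the height of an ideal generated by `c` forms of positive degree is at least `c`, and `c` is
less than the number of variables, then the ideal is saturated: by Cohen-Macaulayness some element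
`a` of the maximal ideal at the vertex is regular modulo the forms, and a power of `a` multiplies
the saturation into the ideal. -/
lemma mem_span_range_of_mem_saturation (hg : ∀ i, (g i).IsHomogeneous (d i)) (hd : ∀ i, 0 < d i)
    (hc : c < m) (hh : (c : ℕ∞) ≤ (Ideal.span (Set.range g)).height)
    {f : MvPolynomial (Fin m) ℂ} {e : ℕ} (hf : f.IsHomogeneous e)
    (hfs : f ∈ saturation (Ideal.span (Set.range g))) : f ∈ Ideal.span (Set.range g) := by
  refine mem_span_of_algebraMap_mem hg hf ?_
  set A := algebraMap (MvPolynomial (Fin m) ℂ) (VertexRing m)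
  set J := (Ideal.span (Set.range g)).map A with hJ
  obtain ⟨r, rfl⟩ := Nat.exists_eq_add_of_lt hc
  have hdim : ringKrullDim (VertexRing (c + r + 1) ⧸ J) ≤ (r + 1 : ℕ) := by
    refine ringKrullDim_quotient_le_of_le_height J (le_height_map_vertexRing hh) ?_
    refine ringKrullDim_vertexRing_le.trans (le_of_eq ?_)
    congr 1
    ring
  have hlist : J = ⊥ ⊔ Ideal.ofList (List.ofFn fun i => A (g i)) := by
    rw [bot_sup_eq, hJ, Ideal.map_span, Ideal.ofList, ← Set.range_comp]
    congr 1
    ext x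
    simp [List.mem_ofFn]
  have hdepth : DepthGE (r + 1) J := by
    rw [hlist] at hdim ⊢
    refine DepthGE.sup_ofList_of_ringKrullDim_le _ ?_ ?_ hdim
    · intro x hx
      obtain ⟨i, rfl⟩ := List.mem_ofFn.1 hx
      rw [IsLocalization.AtPrime.to_map_mem_maximal_iff _ (idealOfVars (Fin (c + r + 1)) ℂ),
        idealOfVars_eq_ker_constantCoeff]
      exact (hg i).coeff_eq_zero (by simpa using (hd i).ne)
    · rw [List.length_ofFn, show r + 1 + c = c + r + 1 by ring]
      exact depthGE_vertexRing
  obtain ⟨a, ham, ha, -⟩ := hdepth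
  obtain ⟨N, hN⟩ := exists_idealOfVars_pow_mul_mem hfs
  have h1 : maximalIdeal (VertexRing (c + r + 1)) ^ N ≤ Submodule.colon J {A f} := by
    rw [← Localization.AtPrime.map_eq_maximalIdeal, ← Ideal.map_pow, Ideal.map_le_iff_le_comap]
    intro v hv
    rw [Ideal.mem_comap, Submodule.mem_colon_singleton, smul_eq_mul]
    change A v * A f ∈ J
    rw [← map_mul]
    exact Ideal.mem_map_of_mem _ (hN v hv)
  have h2 : ∀ k, a ^ k * A f ∈ J → A f ∈ J := fun k => by
    induction k with
    | zero => simp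
    | succ k ih => exact fun h => ih (ha _ (by rwa [← mul_assoc, ← pow_succ']))
  refine h2 N ?_
  have h3 := h1 (Ideal.pow_mem_pow ham N)
  rwa [Submodule.mem_colon_singleton] at h3

/-- An ideal generated by forms of positive degree whose height is the number of variables defines
the empty scheme. -/
lemma one_mem_saturation (hg : ∀ i, (g i).IsHomogeneous (d i))
    (hh : (m : ℕ∞) ≤ (Ideal.span (Set.range g)).height) :
    1 ∈ saturation (Ideal.span (Set.range g)) := by
  intro i
  set A := algebraMap (MvPolynomial (Fin m) ℂ) (VertexRing m)
  have h1 : A (X i) ∈ ((Ideal.span (Set.range g)).map A).radical := by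
    rw [Ideal.radical_eq_sInf, Submodule.mem_sInf]
    rintro (P : Ideal _) ⟨hle, hP : P.IsPrime⟩
    have h2 := (le_height_map_vertexRing hh).trans (Ideal.height_mono hle)
    have h3 : ringKrullDim (VertexRing m) ≤ P.height :=
      ringKrullDim_vertexRing_le.trans (by exact_mod_cast h2)
    have h4 : P = maximalIdeal (VertexRing m) :=
      IsLocalRing.eq_maximalIdeal (Ideal.isMaximal_of_height_eq_ringKrullDim
        (le_antisymm Ideal.height_le_ringKrullDim_of_isPrime h3))
    rw [h4, IsLocalization.AtPrime.to_map_mem_maximal_iff _ (idealOfVars (Fin m) ℂ)]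
    exact Ideal.subset_span ⟨_, rfl⟩
  obtain ⟨k, hk⟩ := h1
  rw [← map_pow] at hk
  exact ⟨k, by rw [mul_one]; exact mem_span_of_algebraMap_mem hg (isHomogeneous_X_pow i k) hk⟩

end CompleteIntersection

/-- The ideal `(l, q)` has height at most two by Krull's theorem, and the prime ideal `(l)` lies
strictly between zero and every prime over `(l, q)`. -/
lemma height_span_pair {m : ℕ} {l q : MvPolynomial (Fin m) ℂ} (hl1 : l.IsHomogeneous 1)
    (hl0 : l ≠ 0) (hq2 : q.IsHomogeneous 2) (hlq : ¬ l ∣ q) :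
    (Ideal.span {l, q}).height = (2 : ℕ) := by
  have hne : Ideal.span {l, q} ≠ ⊤ := by
    have : Ideal.span {l, q} ≤ idealOfVars (Fin m) ℂ := by
      rw [idealOfVars_eq_ker_constantCoeff, Ideal.span_le, Set.insert_subset_iff,
        Set.singleton_subset_iff]
      exact ⟨hl1.coeff_eq_zero (by simp), hq2.coeff_eq_zero (by simp)⟩
    exact ne_top_of_le_ne_top Ideal.IsPrime.ne_top' this
  refine le_antisymm ?_ ?_
  · refine (Ideal.height_le_spanFinrank _ hne).trans ?_
    exact (Nat.cast_le.2 (Submodule.spanFinrank_span_le_ncard_of_finite (Set.toFinite _))).trans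
      (by exact_mod_cast Set.ncard_insert_le l {q} |>.trans (by simp))
  · rw [Ideal.height_eq_inf_minimalPrimes]
    refine le_iInf₂ fun P hP => ?_
    have hPp : P.IsPrime := hP.1.1
    have hle : Ideal.span {l, q} ≤ P := hP.1.2
    have hlp : (Ideal.span {l}).IsPrime :=
      (Ideal.span_singleton_prime hl0).2 (irreducible_of_isHomogeneous_one hl1 hl0).prime
    have h1 : (⊥ : Ideal (MvPolynomial (Fin m) ℂ)) < Ideal.span {l} := by
      rw [bot_lt_iff_ne_bot, ne_eq, Ideal.span_singleton_eq_bot]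
      exact hl0
    have h2 : Ideal.span {l} < P := by
      refine lt_of_le_of_ne ((Ideal.span_mono (by simp)).trans hle) ?_
      rintro rfl
      exact hlq (Ideal.mem_span_singleton.1 (hle (Ideal.subset_span (by simp))))
    have h3 := Ideal.height_add_one_le_of_lt_of_isPrime h1
    have h4 := Ideal.height_add_one_le_of_lt_of_isPrime h2
    refine le_trans ?_ ((add_le_add_left h3 1).trans h4)
    rw [Ideal.height_bot]
    norm_num

lemma IsCodimTwoQuadricCutBy.mem_saturation {m : ℕ} {I : Ideal (MvPolynomial (Fin m) ℂ)}
    {l q : MvPolynomial (Fin m) ℂ} (h : IsCodimTwoQuadricCutBy I l q) :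
    l ∈ saturation I ∧ q ∈ saturation I := by
  have hs : saturation I = saturation (Ideal.span {l, q}) := h.same
  rw [hs]
  exact ⟨le_saturation _ (Ideal.subset_span (by simp)),
    le_saturation _ (Ideal.subset_span (by simp))⟩

lemma IsCodimTwoQuadric.isCompleteIntersection {m : ℕ} {I : Ideal (MvPolynomial (Fin m) ℂ)}
    (h : IsCodimTwoQuadric I) : IsCompleteIntersection I := by
  obtain ⟨l, q, h⟩ := h
  have hr : Set.range ![l, q] = {l, q} := by simp [Set.pair_comm]
  refine ⟨2, ![l, q], fun i => ?_, ?_, ?_⟩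
  · fin_cases i
    · exact ⟨1, one_pos, h.linear⟩
    · exact ⟨2, two_pos, h.quadratic⟩
  · rw [hr, height_span_pair h.linear h.ne_zero h.quadratic h.not_dvd]
  · rw [hr]
    exact h.same

/-- If the base scheme is a complete intersection but lies in no hyperplane, then its equations have
degree at least two, and as its ideal is saturated the forms `F i` are combinations of the
equations of degree two; but there are at most `n` equations. -/
lemma IsQuadraticBirational.exists_linear_of_isCompleteIntersection {n : ℕ}
    {F : Fin (n + 2) → MvPolynomial (Fin (n + 1)) ℂ} {G : MvPolynomial (Fin (n + 2)) ℂ}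
    (hφ : IsQuadraticBirational F G) (h : IsCompleteIntersection (baseIdeal F)) :
    ∃ l : MvPolynomial (Fin (n + 1)) ℂ,
      l.IsHomogeneous 1 ∧ l ∈ saturation (baseIdeal F) ∧ l ≠ 0 := by
  obtain ⟨c, g, hg, hh, hs⟩ := h
  choose d hd hg using hg
  have hs : saturation (baseIdeal F) = saturation (Ideal.span (Set.range g)) := hs
  rcases lt_or_ge c (n + 1) with hc | hc
  · by_contra! hno
    have hg1 : ∀ i, d i = 1 → g i = 0 := fun i hi =>
      hno _ (by simpa [hi] using hg i) (by rw [hs]; exact le_saturation _ (Ideal.subset_span ⟨i, rfl⟩))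
    have hF : Submodule.span ℂ (Set.range F) ≤ Submodule.span ℂ (Set.range g) := by
      rw [Submodule.span_le]
      rintro _ ⟨k, rfl⟩
      have h1 : F k ∈ Ideal.span (Set.range g) :=
        mem_span_range_of_mem_saturation hg hd hc hh.ge (hφ.quadratic k)
          (by rw [← hs]; exact le_saturation _ (Ideal.subset_span ⟨k, rfl⟩))
      obtain ⟨a, ha, ha0, hsum⟩ := exists_homogeneous_coeff_of_mem_span hg (hφ.quadratic k) h1
      rw [SetLike.mem_coe, hsum]
      refine Submodule.sum_mem _ fun i _ => ?_
      rcases lt_trichotomy (d i) 2 with hi | hi | hi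
      · rw [hg1 i (by have := hd i; omega), mul_zero]
        exact Submodule.zero_mem _
      · have h2 : (a i).IsHomogeneous 0 := by simpa [hi] using ha i
        rw [← totalDegree_zero_iff_isHomogeneous, totalDegree_eq_zero_iff_eq_C] at h2
        rw [h2, ← smul_eq_C_mul]
        exact Submodule.smul_mem _ _ (Submodule.subset_span ⟨i, rfl⟩)
      · rw [ha0 i hi, zero_mul]
        exact Submodule.zero_mem _
    have := FiniteDimensional.span_of_finite ℂ (Set.finite_range g)
    have h1 := Submodule.finrank_mono hF
    rw [finrank_span_eq_card hφ.linearIndependent, Fintype.card_fin] at h1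
    have h2 := (finrank_range_le_card (R := ℂ) g : Module.finrank ℂ _ ≤ _)
    rw [Fintype.card_fin] at h2
    have h3 := h1.trans h2
    omega
  · refine ⟨X 0, isHomogeneous_X _ _, ?_, X_ne_zero _⟩
    rw [hs, ← mul_one (X 0)]
    exact Ideal.mul_mem_left _ _ (one_mem_saturation hg (by rw [hh]; exact_mod_cast hc))

end QuadraticMaps

theorem proposition2p2 (n : ℕ) (F : Fin (n + 2) → MvPolynomial (Fin (n + 1)) ℂ)
    (G : MvPolynomial (Fin (n + 2)) ℂ) (hφ : QuadraticMaps.IsQuadraticBirational F G) :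
    List.TFAE [
      Module.finrank ℂ (QuadraticMaps.twistedSections (QuadraticMaps.baseIdeal F) 1) ≠ 0,
      QuadraticMaps.IsCodimTwoQuadric (QuadraticMaps.baseIdeal F),
      QuadraticMaps.IsCompleteIntersection (QuadraticMaps.baseIdeal F),
      QuadraticMaps.IsOfTypeTwo F G 1] ∧
    (Module.finrank ℂ (QuadraticMaps.twistedSections (QuadraticMaps.baseIdeal F) 1) ≠ 0 ∨
      QuadraticMaps.IsCodimTwoQuadric (QuadraticMaps.baseIdeal F) ∨
      QuadraticMaps.IsCompleteIntersection (QuadraticMaps.baseIdeal F) ∨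
      QuadraticMaps.IsOfTypeTwo F G 1 →
      G.IsHomogeneous 2 ∧
      ∀ l q, QuadraticMaps.IsCodimTwoQuadricCutBy (QuadraticMaps.baseIdeal F) l q →
        QuadraticMaps.rankOn q (QuadraticMaps.hyperplane l) + 2 =
          QuadraticMaps.rankOn G ⊤) := by
  open QuadraticMaps in
  have h12 : Module.finrank ℂ (twistedSections (baseIdeal F) 1) ≠ 0 →
      IsCodimTwoQuadric (baseIdeal F) := fun h => by
    obtain ⟨l, hl1, hl, hl0⟩ := (finrank_twistedSections_ne_zero_iff _ _).1 h
    exact hφ.isCodimTwoQuadric hl1 hl0 hl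
  have h23 : IsCodimTwoQuadric (baseIdeal F) → IsCompleteIntersection (baseIdeal F) :=
    fun h => h.isCompleteIntersection
  have h31 : IsCompleteIntersection (baseIdeal F) →
      Module.finrank ℂ (twistedSections (baseIdeal F) 1) ≠ 0 := fun h =>
    (finrank_twistedSections_ne_zero_iff _ _).2 (hφ.exists_linear_of_isCompleteIntersection h)
  have h24 : IsCodimTwoQuadric (baseIdeal F) → IsOfTypeTwo F G 1 := by
    rintro ⟨l, q, h⟩
    obtain ⟨hl, hq⟩ := h.mem_saturation
    obtain ⟨H, Z, hHZ⟩ := hφ.exists_isAdaptedCoordinates h.linear hl h.quadratic hq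
    exact hφ.isOfTypeTwo_one h.ne_zero hHZ
  have h41 : IsOfTypeTwo F G 1 → Module.finrank ℂ (twistedSections (baseIdeal F) 1) ≠ 0 := by
    rintro ⟨⟨H, hH⟩, -⟩
    exact (finrank_twistedSections_ne_zero_iff _ _).2 (hφ.exists_linear_of_isInverse hH)
  refine ⟨?_, fun h => ?_⟩
  · tfae_have 1 → 2 := h12
    tfae_have 2 → 3 := h23
    tfae_have 3 → 1 := h31
    tfae_have 2 → 4 := h24
    tfae_have 4 → 1 := h41
    tfae_finish
  · have h2 : IsCodimTwoQuadric (baseIdeal F) := by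
      rcases h with h | h | h | h
      exacts [h12 h, h, h12 (h31 h), h12 (h41 h)]
    have key : ∀ l q, IsCodimTwoQuadricCutBy (baseIdeal F) l q →
        G.IsHomogeneous 2 ∧ rankOn q (hyperplane l) + 2 = rankOn G ⊤ := fun l q h => by
      obtain ⟨hl, hq⟩ := h.mem_saturation
      obtain ⟨H, Z, hHZ⟩ := hφ.exists_isAdaptedCoordinates h.linear hl h.quadratic hq
      have hbij := hHZ.bijective hφ h.linear h.ne_zero hl h.quadratic hq h.not_dvd
      exact ⟨(hHZ.exists_smul_eq hφ h.linear h.ne_zero h.quadratic hbij).1,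
        hHZ.rankOn_add_two hφ h.linear h.ne_zero h.quadratic hbij⟩
    obtain ⟨l, q, h⟩ := h2
    exact ⟨(key l q h).1, fun l q h => (key l q h).2⟩
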